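/- Let $N \ge 2$, let $\Omega = \mathbb{R}^N_+ = \{x \in \mathbb{R}^N : x_N > 0\}$, and let $\phi \in C^1(\mathbb{R}^N_+) \cap C(\overline{\mathbb{R}^N_+})$ be of the form $$\phi(x) = \prod_{i=1}^N \phi_i(x_i), \qquad x \in \mathbb{R}^N_+,$$ where $\phi_i \in C^2(\mathbb{R})$ and $\phi_i(t) > 0$ for all $t \in \mathbb{R}$ ($i = 1, \dots, N-1$), and $\phi_N \in C^2((0,\infty)) \cap C([0,\infty))$ with $\phi_N(t) > 0$ for $t > 0$. For a Lebesgue measurable set $M \subset \Omega$ put $$\nu(M) = \int_M \phi \, dx, \qquad P_\nu(M, \Omega) = \sup\left\{ \int_M \operatorname{div}(\phi \mathbf{v}) \, dx : \mathbf{v} \in C^1_c(\Omega, \mathbb{R}^N),\ |\mathbf{v}| \le 1 \right\} \in [0, \infty],$$ where $C^1_c(\Omega,\mathbb{R}^N)$ is the space of $C^1$ vector fields with compact support in $\Omega$, and for $m > 0$ put $$I_\nu(m) = \inf\{ P_\nu(M, \Omega) : M \subset \Omega \text{ measurable},\ \nu(M) = m \}.$$ Let $B_R$ be the ball of radius $R$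 centered at the origin. Suppose that for every $R > 0$ the half-ball $B_R \cap \mathbb{R}^N_+$ is isoperimetric, that is, $I_\nu(m) = P_\nu(B_R \cap \mathbb{R}^N_+, \mathbb{R}^N_+)$ with $m = \nu(B_R \cap \mathbb{R}^N_+)$. Then there are numbers $a > 0$, $k \ge 0$ and $c \ge 0$ such that $$\phi(x) = a\, x_N^k\, e^{c|x|^2} \qquad \text{for all } x \in \mathbb{R}^N_+ .$$ -/

import Mathlib

open MeasureTheory Set
open scoped ENNReal

noncomputable section

namespace WeightedIso

/-- The open half space of points of `ℝ^(n+1)` whose last coordinate is positive. -/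
def halfSpace (n : ℕ) : Set (EuclideanSpace ℝ (Fin (n + 1))) :=
  {x | 0 < x (Fin.last n)}

/-- The divergence `∑ i, ∂ w_i / ∂ x_i` of a vector field at the point `x`. -/
def divergence {N : ℕ} (w : EuclideanSpace ℝ (Fin N) → EuclideanSpace ℝ (Fin N))
    (x : EuclideanSpace ℝ (Fin N)) : ℝ :=
  ∑ i : Fin N, (fderiv ℝ w x (EuclideanSpace.single i 1)) i

/-- The measure of `M` with respect to `dν = φ dx`, for a nonnegative density `φ`. -/
def weightedVolume {N : ℕ} (φ : EuclideanSpace ℝ (Fin N) → ℝ)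
    (M : Set (EuclideanSpace ℝ (Fin N))) : ℝ≥0∞ :=
  ∫⁻ x in M, ENNReal.ofReal (φ x)

/-- The vector fields of class `C¹` with compact support contained in `Ω` and of
pointwise Euclidean norm at most one. -/
def testFields {N : ℕ} (Ω : Set (EuclideanSpace ℝ (Fin N))) :
    Set (EuclideanSpace ℝ (Fin N) → EuclideanSpace ℝ (Fin N)) :=
  {v | ContDiff ℝ 1 v ∧ HasCompactSupport v ∧ tsupport v ⊆ Ω ∧ ∀ x, ‖v x‖ ≤ 1}

/-- The weighted perimeter of `M` relative to the open set `Ω`: the supremum, in the extended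
reals, of `∫_M div (φ v) dx` over all test fields `v`. For `M ⊆ Ω` and a density `φ` of class
`C¹` on `Ω` every one of these integrals converges. -/
def weightedPerimeter {N : ℕ} (Ω : Set (EuclideanSpace ℝ (Fin N)))
    (φ : EuclideanSpace ℝ (Fin N) → ℝ) (M : Set (EuclideanSpace ℝ (Fin N))) : EReal :=
  ⨆ v ∈ testFields Ω, ((∫ x in M, divergence (fun y => φ y • v y) x : ℝ) : EReal)

/-- The isoperimetric profile: the infimum of the weighted perimeters relative to `Ω` of the
Lebesgue measurable subsets of `Ω` of weighted volume `m`. -/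
def isoperimetricProfile {N : ℕ} (Ω : Set (EuclideanSpace ℝ (Fin N)))
    (φ : EuclideanSpace ℝ (Fin N) → ℝ) (m : ℝ≥0∞) : EReal :=
  sInf {p | ∃ M : Set (EuclideanSpace ℝ (Fin N)), NullMeasurableSet M volume ∧ M ⊆ Ω ∧
    weightedVolume φ M = m ∧ p = weightedPerimeter Ω φ M}

end WeightedIso

end

/-!
Write `Ω` for the half space, `Φ(r, σ) = r ^ n * φ (r σ)` for the density in polar coordinates,
and `A(R)` for the integral of `Φ(R, ·)` over the open upper unit hemisphere. After replacing `φ`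
by a continuous extension to the whole space, which changes neither volumes nor perimeters of
subsets of `Ω`, the argument has three parts.

*First variation.* The weighted area `A(R)` is a lower bound for the perimeter of the half-ball of
radius `R` (`le_weightedPerimeter_halfBall`: test with radial fields and integrate along rays).
Conversely, if `G` is homogeneous of degree zero with `‖DG‖ ≤ L`, then the star-shaped set
`{‖x‖ < R + G x}` and its complement have perimeter at most
`(1 + L ^ 2) * ∫ Φ(R + G σ, σ) dσ` (`IsRadialPerturbation.weightedPerimeter_le`). The error is
quadratic in `L` since the gradient of `G` is orthogonal to the radial direction. If the radial
logarithmic derivative `x · ∇φ / φ`, and with it the mean curvature, took different values at two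
points of the same hemisphere, one could push the hemisphere outwards near the point with the
smaller value and pull it inwards near the other one, keeping the volume fixed; the perimeter would
decrease to first order, while the error is of second order. Hence `x · ∇φ / φ` depends on `‖x‖`
only (`HalfBallsMinimize.radialLogDeriv_eq`).

*Functional equation.* For a product density `x · ∇φ / φ` is the sum of the functions
`ψᵢ(t) = t φᵢ'(t) / φᵢ(t)` of the coordinates. Evaluating on the planes spanned by the `i`-th and
the last axis gives `ψᵢ(s) + ψ_N(t) = ψ_N(√(s² + t²))`, which forces `ψᵢ(s) = d s²` and
`ψ_N(t) = e + d t²` (`exists_affine_of_add_sq`). Integrating, `φ = a x_N ^ e exp (d ‖x‖² / 2)`, and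
`e ≥ 0` because `φ_N` is continuous at `0`.

*Sign of the exponent.* If `d < 0`, the total volume is finite. The complement of a very large
half-ball then has the same volume as some small half-ball but, because of the Gaussian decay,
much smaller perimeter (`exists_integral_gaussProfile_eq_and_lt`,
`HalfBallsMinimize.exponent_nonneg`).
-/

open Filter Topology

noncomputable section

namespace WeightedIso

/-! ### Polar coordinates in the half space -/

section

/-- The Euclidean space of dimension `n + 1`; the half space is cut out by the last coordinate. -/
abbrev Space (n : ℕ) : Type := EuclideanSpace ℝ (Fin (n + 1))

/-- The unit sphere of `Space n`, as a type. -/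
abbrev UnitSphere (n : ℕ) : Type := Metric.sphere (0 : Space n) 1

/-- The open upper unit hemisphere. -/
def upperSphere (n : ℕ) : Set (UnitSphere n) := {σ | 0 < (σ : Space n) (Fin.last n)}

/-- The surface measure of the unit sphere restricted to the open upper hemisphere, as a measure
on the whole sphere. Thus continuous functions on the compact sphere are integrable. -/
def hemi (n : ℕ) : Measure (UnitSphere n) :=
  (volume : Measure (Space n)).toSphere.restrict (upperSphere n)

lemma isOpen_halfSpace (n : ℕ) : IsOpen (halfSpace n) :=
  isOpen_lt continuous_const (by fun_prop)

lemma isOpen_upperSphere (n : ℕ) : IsOpen (upperSphere n) :=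
  isOpen_lt continuous_const (by fun_prop)

instance (n : ℕ) : IsFiniteMeasure (hemi n) := by unfold hemi; infer_instance

lemma smul_mem_halfSpace {n : ℕ} {r : ℝ} (hr : 0 < r) (x : Space n) :
    r • x ∈ halfSpace n ↔ x ∈ halfSpace n := by
  simp [halfSpace, hr]

lemma integrable_continuous_hemi {n : ℕ} {f : UnitSphere n → ℝ} (hf : Continuous f) :
    Integrable f (hemi n) := by
  have : Integrable f (volume : Measure (Space n)).toSphere :=
    hf.integrable_of_hasCompactSupport (HasCompactSupport.of_compactSpace f)
  exact this.restrict

lemma lintegral_polar {n : ℕ} (f : Space n → ℝ≥0∞) (hf : Measurable f) :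
    ∫⁻ x, f x = ∫⁻ σ : UnitSphere n,
        (∫⁻ r in Ioi (0 : ℝ), ENNReal.ofReal (r ^ n) * f (r • (σ : Space n)))
      ∂(volume : Measure (Space n)).toSphere := by
  have hmp := (volume : Measure (Space n)).measurePreserving_homeomorphUnitSphereProd
  have hdim : Module.finrank ℝ (Space n) - 1 = n := by simp
  rw [hdim] at hmp
  have h1 : ∫⁻ x, f x = ∫⁻ x : ({(0 : Space n)}ᶜ : Set (Space n)), f x
      ∂((volume : Measure (Space n)).comap (↑)) := by
    rw [lintegral_subtype_comap (measurableSet_singleton _).compl f, restrict_compl_singleton]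
  have h2 := hmp.lintegral_comp_emb (Homeomorph.measurableEmbedding _)
    (fun p : UnitSphere n × Ioi (0 : ℝ) => f ((p.2 : ℝ) • (p.1 : Space n)))
  have h3 : ∀ x : ({(0 : Space n)}ᶜ : Set (Space n)),
      (((homeomorphUnitSphereProd (Space n)) x).2 : ℝ) •
        (((homeomorphUnitSphereProd (Space n)) x).1 : Space n) = x := by
    intro x
    have hx : (x : Space n) ≠ 0 := x.2
    simp [smul_smul, hx]
  simp only [h3] at h2
  rw [h1, h2, lintegral_prod _ (by fun_prop)]
  refine lintegral_congr fun σ => ?_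
  rw [Measure.volumeIoiPow, lintegral_withDensity_eq_lintegral_mul _ (by fun_prop) (by fun_prop)]
  exact lintegral_subtype_comap measurableSet_Ioi
    (fun r : ℝ => ENNReal.ofReal (r ^ n) * f (r • (σ : Space n)))

lemma integral_polar {n : ℕ} (f : Space n → ℝ) (hf : Integrable f) :
    ∫ x, f x = ∫ σ : UnitSphere n, (∫ r in Ioi (0 : ℝ), r ^ n * f (r • (σ : Space n)))
      ∂(volume : Measure (Space n)).toSphere := by
  have hmp := (volume : Measure (Space n)).measurePreserving_homeomorphUnitSphereProd
  have hdim : Module.finrank ℝ (Space n) - 1 = n := by simp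
  rw [hdim] at hmp
  have h1 : ∫ x, f x = ∫ x : ({(0 : Space n)}ᶜ : Set (Space n)), f x
      ∂((volume : Measure (Space n)).comap (↑)) := by
    rw [integral_subtype_comap (measurableSet_singleton _).compl f, restrict_compl_singleton]
  have h2 := hmp.integral_comp (Homeomorph.measurableEmbedding _)
    (fun p : UnitSphere n × Ioi (0 : ℝ) => f ((p.2 : ℝ) • (p.1 : Space n)))
  have h4 := hmp.integrable_comp_emb (Homeomorph.measurableEmbedding _)
    (g := fun p : UnitSphere n × Ioi (0 : ℝ) => f ((p.2 : ℝ) • (p.1 : Space n)))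
  have h3 : ∀ x : ({(0 : Space n)}ᶜ : Set (Space n)),
      (((homeomorphUnitSphereProd (Space n)) x).2 : ℝ) •
        (((homeomorphUnitSphereProd (Space n)) x).1 : Space n) = x := by
    intro x
    have hx : (x : Space n) ≠ 0 := x.2
    simp [smul_smul, hx]
  simp only [h3] at h2
  simp only [Function.comp_def, h3] at h4
  have h5 : Integrable (fun x : ({(0 : Space n)}ᶜ : Set (Space n)) => f x)
      ((volume : Measure (Space n)).comap (↑)) :=
    (integrableOn_iff_comap_subtypeVal (measurableSet_singleton _).compl).1 hf.integrableOn
  rw [h1, h2, integral_prod _ (h4.1 h5)]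
  refine integral_congr_ae (Eventually.of_forall fun σ => ?_)
  simp only [Measure.volumeIoiPow, ENNReal.ofReal]
  rw [integral_withDensity_eq_integral_smul (by fun_prop)]
  refine Eq.trans (integral_subtype_comap measurableSet_Ioi
    (fun r : ℝ => Real.toNNReal (r ^ n) • f (r • (σ : Space n)))) ?_
  refine setIntegral_congr_fun measurableSet_Ioi fun x hx => ?_
  simp only [NNReal.smul_def, Real.coe_toNNReal _ (pow_nonneg (le_of_lt hx) _), smul_eq_mul]

lemma lintegral_halfSpace_polar {n : ℕ} (f : Space n → ℝ≥0∞) (hf : Measurable f) :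
    ∫⁻ x in halfSpace n, f x =
      ∫⁻ σ : UnitSphere n,
        (∫⁻ r in Ioi (0 : ℝ), ENNReal.ofReal (r ^ n) * f (r • (σ : Space n))) ∂(hemi n) := by
  have hm := (isOpen_halfSpace n).measurableSet
  rw [← lintegral_indicator hm, lintegral_polar _ (hf.indicator hm), hemi,
    ← lintegral_indicator (isOpen_upperSphere n).measurableSet]
  refine lintegral_congr fun σ => ?_
  by_cases hσ : σ ∈ upperSphere n
  · rw [indicator_of_mem hσ]
    refine setLIntegral_congr_fun measurableSet_Ioi fun r hr => ?_
    rw [indicator_of_mem ((smul_mem_halfSpace hr _).2 hσ)]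
  · rw [indicator_of_notMem hσ]
    refine (setLIntegral_congr_fun measurableSet_Ioi (g := fun _ => 0) fun r hr => ?_).trans
      (by simp)
    simp only
    rw [indicator_of_notMem (fun h => hσ ((smul_mem_halfSpace hr _).1 h)), mul_zero]

lemma integral_halfSpace_polar {n : ℕ} (f : Space n → ℝ)
    (hf : IntegrableOn f (halfSpace n)) :
    ∫ x in halfSpace n, f x =
      ∫ σ : UnitSphere n, (∫ r in Ioi (0 : ℝ), r ^ n * f (r • (σ : Space n))) ∂(hemi n) := by
  have hm := (isOpen_halfSpace n).measurableSet
  rw [← integral_indicator hm, integral_polar _ ((integrable_indicator_iff hm).2 hf), hemi,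
    ← integral_indicator (isOpen_upperSphere n).measurableSet]
  refine integral_congr_ae (Eventually.of_forall fun σ => ?_)
  simp only
  by_cases hσ : σ ∈ upperSphere n
  · rw [indicator_of_mem hσ]
    refine setIntegral_congr_fun measurableSet_Ioi fun r hr => ?_
    rw [indicator_of_mem ((smul_mem_halfSpace hr _).2 hσ)]
  · rw [indicator_of_notMem hσ]
    refine (setIntegral_congr_fun measurableSet_Ioi (g := fun _ => 0) fun r hr => ?_).trans
      (by simp)
    simp only
    rw [indicator_of_notMem (fun h => hσ ((smul_mem_halfSpace hr _).1 h)), mul_zero]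

/-! ### Upper bounds for the perimeter by approximation -/

section Perimeter

variable {N : ℕ} {Ω : Set (EuclideanSpace ℝ (Fin N))} {φ : EuclideanSpace ℝ (Fin N) → ℝ}
  {v : EuclideanSpace ℝ (Fin N) → EuclideanSpace ℝ (Fin N)}

lemma contDiff_weighted_field (hΩ : IsOpen Ω) (hφ : ContDiffOn ℝ 1 φ Ω) (hv : v ∈ testFields Ω) :
    ContDiff ℝ 1 (fun y => φ y • v y) := by
  rw [contDiff_iff_contDiffAt]
  intro x
  by_cases hx : x ∈ tsupport v
  · exact (hφ.contDiffAt (hΩ.mem_nhds (hv.2.2.1 hx))).smul hv.1.contDiffAt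
  · have : (fun y => φ y • v y) =ᶠ[𝓝 x] fun _ => 0 := by
      filter_upwards [(isClosed_tsupport v).isOpen_compl.mem_nhds hx] with y hy
      rw [image_eq_zero_of_notMem_tsupport hy, smul_zero]
    exact contDiffAt_const.congr_of_eventuallyEq this

lemma continuous_divergence (hv : ContDiff ℝ 1 v) : Continuous (divergence v) := by
  unfold divergence
  have := hv.continuous_fderiv one_ne_zero
  fun_prop

lemma divergence_eq_zero_of_notMem_tsupport {x : EuclideanSpace ℝ (Fin N)}
    (hx : x ∉ tsupport v) : divergence v x = 0 := by
  simp [divergence, fderiv_of_notMem_tsupport ℝ hx]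

lemma hasCompactSupport_divergence (hv : HasCompactSupport v) :
    HasCompactSupport (divergence v) :=
  HasCompactSupport.intro hv fun _ hx => divergence_eq_zero_of_notMem_tsupport hx

/-- Integration by parts: no boundary term occurs, as the field has compact support. -/
lemma integral_mul_divergence {w : EuclideanSpace ℝ (Fin N) → EuclideanSpace ℝ (Fin N)}
    {ζ : EuclideanSpace ℝ (Fin N) → ℝ} (hw : ContDiff ℝ 1 w) (hwc : HasCompactSupport w)
    (hζ : ContDiff ℝ 1 ζ) :
    ∫ x, ζ x * divergence w x = - ∫ x, fderiv ℝ ζ x (w x) := by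
  have hcf := hw.continuous_fderiv one_ne_zero
  have hcz := hζ.continuous_fderiv one_ne_zero
  have hcw := hw.continuous
  have hc := hζ.continuous
  have key : ∀ i : Fin N, ∫ x, ζ x * (fderiv ℝ w x (EuclideanSpace.single i 1)) i =
      - ∫ x, fderiv ℝ ζ x (EuclideanSpace.single i 1) * w x i := by
    intro i
    have hd : ∀ x, fderiv ℝ (fun y => w y i) x (EuclideanSpace.single i 1) =
        (fderiv ℝ w x (EuclideanSpace.single i 1)) i := by
      intro x
      have h := (hw.differentiable one_ne_zero x).hasFDerivAt
      have h2 := ((EuclideanSpace.proj i : EuclideanSpace ℝ (Fin N) →L[ℝ] ℝ).hasFDerivAt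
        (x := w x)).comp x h
      have h3 : fderiv ℝ (fun y => w y i) x = _ := h2.fderiv
      rw [h3]; rfl
    have h := integral_mul_fderiv_eq_neg_fderiv_mul_of_integrable
      (μ := (volume : Measure (EuclideanSpace ℝ (Fin N))))
      (f := ζ) (g := fun y => w y i) (v := EuclideanSpace.single i 1) ?_ ?_ ?_ ?_ ?_
    · simpa only [hd] using h
    · refine Continuous.integrable_of_hasCompactSupport (by fun_prop) ?_
      exact HasCompactSupport.intro hwc fun x hx => by
        simp [image_eq_zero_of_notMem_tsupport hx]
    · simp only [hd]
      refine Continuous.integrable_of_hasCompactSupport (by fun_prop) ?_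
      refine HasCompactSupport.intro hwc fun x hx => ?_
      simp [fderiv_of_notMem_tsupport ℝ hx]
    · refine Continuous.integrable_of_hasCompactSupport (by fun_prop) ?_
      exact HasCompactSupport.intro hwc fun x hx => by
        simp [image_eq_zero_of_notMem_tsupport hx]
    · exact fun x _ => hζ.differentiable one_ne_zero x
    · intro x _
      have := hw.differentiable one_ne_zero
      fun_prop
  have hi1 : ∀ i ∈ (Finset.univ : Finset (Fin N)),
      Integrable fun x => ζ x * (fderiv ℝ w x (EuclideanSpace.single i 1)) i := by
    intro i _
    refine Continuous.integrable_of_hasCompactSupport (by fun_prop) ?_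
    refine HasCompactSupport.intro hwc fun x hx => ?_
    simp [fderiv_of_notMem_tsupport ℝ hx]
  have hi2 : ∀ i ∈ (Finset.univ : Finset (Fin N)),
      Integrable fun x => fderiv ℝ ζ x (EuclideanSpace.single i 1) * w x i := by
    intro i _
    refine Continuous.integrable_of_hasCompactSupport (by fun_prop) ?_
    exact HasCompactSupport.intro hwc fun x hx => by
      simp [image_eq_zero_of_notMem_tsupport hx]
  have e2 : ∀ x, fderiv ℝ ζ x (w x) = ∑ i, fderiv ℝ ζ x (EuclideanSpace.single i 1) * w x i := by
    intro x
    conv_lhs => rw [← (EuclideanSpace.basisFun (Fin N) ℝ).sum_repr (w x)]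
    rw [map_sum]
    refine Finset.sum_congr rfl fun i _ => ?_
    simp [mul_comm]
  simp only [divergence, Finset.mul_sum, e2]
  rw [integral_finsetSum _ hi1, integral_finsetSum _ hi2, ← Finset.sum_neg_distrib]
  exact Finset.sum_congr rfl fun i _ => key i

/-- A set has weighted perimeter at most `K` if its indicator function is a pointwise limit of
`C¹` functions with values in `[0, 1]` whose weighted total variations are at most `K`. -/
lemma weightedPerimeter_le_of_approx {M : Set (EuclideanSpace ℝ (Fin N))} (hΩ : IsOpen Ω)
    (hφ : ContDiffOn ℝ 1 φ Ω) (hpos : ∀ x ∈ Ω, 0 ≤ φ x) (hM : MeasurableSet M)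
    {ζ : ℕ → EuclideanSpace ℝ (Fin N) → ℝ} (hζ : ∀ k, ContDiff ℝ 1 (ζ k))
    (hζ0 : ∀ k x, 0 ≤ ζ k x) (hζ1 : ∀ k x, ζ k x ≤ 1)
    (hlim : ∀ x ∈ Ω, Tendsto (fun k => ζ k x) atTop (𝓝 (M.indicator 1 x)))
    {K : ℝ} (hK0 : 0 ≤ K)
    (hle : ∀ k, ∫⁻ x in Ω, ENNReal.ofReal (‖fderiv ℝ (ζ k) x‖ * φ x) ≤ ENNReal.ofReal K) :
    weightedPerimeter Ω φ M ≤ (K : EReal) := by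
  refine iSup₂_le fun v hv => ?_
  rw [EReal.coe_le_coe_iff]
  set w : EuclideanSpace ℝ (Fin N) → EuclideanSpace ℝ (Fin N) := fun y => φ y • v y with hw
  have hwd : ContDiff ℝ 1 w := contDiff_weighted_field hΩ hφ hv
  have hts : tsupport w ⊆ tsupport v := closure_mono fun x hx hvx => hx (by simp [hw, hvx])
  have hwc : HasCompactSupport w :=
    HasCompactSupport.intro hv.2.1 fun x hx => by
      simp [hw, image_eq_zero_of_notMem_tsupport hx]
  have hdc := continuous_divergence hwd
  have hdi : Integrable (divergence w) :=
    hdc.integrable_of_hasCompactSupport (hasCompactSupport_divergence hwc)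
  have hlim2 : Tendsto (fun k => ∫ x, ζ k x * divergence w x) atTop
      (𝓝 (∫ x, M.indicator 1 x * divergence w x)) := by
    refine tendsto_integral_of_dominated_convergence (fun x => ‖divergence w x‖) ?_ hdi.norm ?_ ?_
    · intro k
      have := (hζ k).continuous
      exact (this.mul hdc).aestronglyMeasurable
    · intro k
      refine Eventually.of_forall fun x => ?_
      rw [norm_mul]
      refine mul_le_of_le_one_left (norm_nonneg _) ?_
      rw [Real.norm_of_nonneg (hζ0 k x)]
      exact hζ1 k x
    · refine Eventually.of_forall fun x => ?_
      by_cases hx : x ∈ Ω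
      · exact (hlim x hx).mul_const _
      · have : divergence w x = 0 :=
          divergence_eq_zero_of_notMem_tsupport fun h => hx (hv.2.2.1 (hts h))
        simp [this]
  have hfin : ∫ x in M, divergence w x = ∫ x, M.indicator 1 x * divergence w x := by
    rw [← integral_indicator hM]
    congr 1
    ext x
    by_cases hx : x ∈ M <;> simp [hx]
  rw [hfin]
  refine le_of_tendsto' hlim2 fun k => ?_
  rw [integral_mul_divergence hwd hwc (hζ k)]
  refine (neg_le_abs _).trans ?_
  rw [← Real.norm_eq_abs]
  refine (norm_integral_le_lintegral_norm _).trans ?_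
  refine ENNReal.toReal_le_of_le_ofReal hK0 (le_trans ?_ (hle k))
  rw [← lintegral_indicator hΩ.measurableSet]
  refine lintegral_mono fun x => ?_
  by_cases hx : x ∈ Ω
  · rw [indicator_of_mem hx]
    refine ENNReal.ofReal_le_ofReal ?_
    refine ((fderiv ℝ (ζ k) x).le_opNorm _).trans ?_
    refine mul_le_mul_of_nonneg_left ?_ (norm_nonneg _)
    rw [hw, norm_smul, Real.norm_of_nonneg (hpos x hx)]
    exact mul_le_of_le_one_right (hpos x hx) (hv.2.2.2 x)
  · have : w x = 0 := image_eq_zero_of_notMem_tsupport fun h => hx (hv.2.2.1 (hts h))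
    simp [this]

end Perimeter

end

/-! ### A lower bound for the perimeter of half-balls -/

section

/-- The density of the weighted volume in polar coordinates `(r, σ)`. -/
def radialDensity {n : ℕ} (φ : Space n → ℝ) (r : ℝ) (σ : UnitSphere n) : ℝ :=
  r ^ n * φ (r • (σ : Space n))

lemma continuous_radialDensity {n : ℕ} {φ : Space n → ℝ} (hφ : Continuous φ) :
    Continuous fun p : ℝ × UnitSphere n => radialDensity φ p.1 p.2 := by
  unfold radialDensity
  fun_prop

lemma norm_unitSphere {n : ℕ} (σ : UnitSphere n) : ‖(σ : Space n)‖ = 1 := by simp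

lemma norm_smul_unitSphere {n : ℕ} (σ : UnitSphere n) {r : ℝ} (hr : 0 ≤ r) :
    ‖r • (σ : Space n)‖ = r := by
  rw [norm_smul, norm_unitSphere, mul_one, Real.norm_of_nonneg hr]

lemma unitSphere_ne_zero {n : ℕ} (σ : UnitSphere n) : (σ : Space n) ≠ 0 := by
  intro h
  have := norm_unitSphere σ
  simp [h] at this

lemma ne_zero_of_mem_halfSpace {n : ℕ} {x : Space n} (hx : x ∈ halfSpace n) : x ≠ 0 := by
  rintro rfl
  simp [halfSpace] at hx

/-- The divergence of a radial field `κ x • x`. At `x = r • σ` it is `r ^ (1 - N)` times the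
derivative of `r ^ N * κ (r • σ)` in `r`. -/
lemma divergence_smul_self {N : ℕ} {κ : EuclideanSpace ℝ (Fin N) → ℝ}
    {x : EuclideanSpace ℝ (Fin N)} (hκ : DifferentiableAt ℝ κ x) :
    divergence (fun y => κ y • y) x = N * κ x + fderiv ℝ κ x x := by
  have h : fderiv ℝ (fun y => κ y • y) x = κ x • ContinuousLinearMap.id ℝ _ +
      (fderiv ℝ κ x).smulRight x := (hκ.hasFDerivAt.smul (hasFDerivAt_id x)).fderiv
  have e2 : fderiv ℝ κ x x = ∑ i, fderiv ℝ κ x (EuclideanSpace.single i 1) * x i := by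
    conv_lhs => rw [← (EuclideanSpace.basisFun (Fin N) ℝ).sum_repr x]
    rw [map_sum, (EuclideanSpace.basisFun (Fin N) ℝ).sum_repr x]
    refine Finset.sum_congr rfl fun i _ => ?_
    simp [mul_comm]
  rw [divergence, h, e2]
  simp [Finset.sum_add_distrib]

section Cutoff

variable {n : ℕ}

/-- A cutoff function with values in `[0, 1]`. The first factor vanishes on the cone `x_N ≤ ε *
‖x‖` and equals one where `x_N ≥ 2 * ε * ‖x‖`; the other two confine the support to `R / 4 ≤ ‖x‖ ≤
3 * R` and equal one for `R / 2 ≤ ‖x‖ ≤ 2 * R`. -/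
def radialCutoff (n : ℕ) (R ε : ℝ) (x : Space n) : ℝ :=
  Real.smoothTransition (x (Fin.last n) / ‖x‖ / ε - 1) *
    (Real.smoothTransition (4 * ‖x‖ / R - 1) * Real.smoothTransition (3 - ‖x‖ / R))

lemma radialCutoff_nonneg (R ε : ℝ) (x : Space n) : 0 ≤ radialCutoff n R ε x :=
  mul_nonneg (Real.smoothTransition.nonneg _)
    (mul_nonneg (Real.smoothTransition.nonneg _) (Real.smoothTransition.nonneg _))

lemma radialCutoff_le_one (R ε : ℝ) (x : Space n) : radialCutoff n R ε x ≤ 1 :=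
  mul_le_one₀ (Real.smoothTransition.le_one _)
    (mul_nonneg (Real.smoothTransition.nonneg _) (Real.smoothTransition.nonneg _))
    (mul_le_one₀ (Real.smoothTransition.le_one _) (Real.smoothTransition.nonneg _)
      (Real.smoothTransition.le_one _))

lemma radialCutoff_eq_zero_of_norm_le {R : ℝ} (hR : 0 < R) (ε : ℝ) {x : Space n}
    (hx : ‖x‖ ≤ R / 4) : radialCutoff n R ε x = 0 := by
  have : Real.smoothTransition (4 * ‖x‖ / R - 1) = 0 := by
    apply Real.smoothTransition.zero_of_nonpos
    rw [sub_nonpos, div_le_one hR]; linarith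
  simp [radialCutoff, this]

lemma contDiffAt_radialCutoff (R ε : ℝ) {x : Space n} (hx : x ≠ 0) :
    ContDiffAt ℝ 1 (radialCutoff n R ε) x := by
  have hn : ContDiffAt ℝ 1 (fun y : Space n => ‖y‖) x := contDiffAt_norm ℝ hx
  have hl : ContDiffAt ℝ 1 (fun y : Space n => y (Fin.last n)) x := by fun_prop
  have hx' : ‖x‖ ≠ 0 := norm_ne_zero_iff.2 hx
  have hst : ContDiff ℝ 1 Real.smoothTransition := Real.smoothTransition.contDiff
  refine ContDiffAt.mul ?_ (ContDiffAt.mul ?_ ?_)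
  · exact hst.contDiffAt.comp x (((hl.div hn hx').div_const _).sub contDiffAt_const)
  · exact hst.contDiffAt.comp x (((contDiffAt_const.mul hn).div_const _).sub contDiffAt_const)
  · exact hst.contDiffAt.comp x (contDiffAt_const.sub (hn.div_const _))

/-- The outward unit radial field multiplied by `radialCutoff`. -/
def radialField (n : ℕ) (R ε : ℝ) (x : Space n) : Space n :=
  (radialCutoff n R ε x * ‖x‖⁻¹) • x

lemma radialField_mem_testFields {R ε : ℝ} (hR : 0 < R) (hε : 0 < ε) :
    radialField n R ε ∈ testFields (halfSpace n) := by
  have hsub : tsupport (radialField n R ε) ⊆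
      {x | R / 4 ≤ ‖x‖} ∩ ({x | ‖x‖ ≤ 3 * R} ∩ {x | ε * ‖x‖ ≤ x (Fin.last n)}) := by
    refine closure_minimal ?_ ?_
    · intro x hx
      have hx0 : radialCutoff n R ε x ≠ 0 := by
        intro h; exact hx (by simp [radialField, h])
      have h1 : R / 4 < ‖x‖ := by
        by_contra h
        exact hx0 (radialCutoff_eq_zero_of_norm_le hR ε (not_lt.1 h))
      have h0 : 0 < ‖x‖ := by linarith
      refine ⟨h1.le, ?_, ?_⟩
      · by_contra h
        rw [mem_ofPred_eq, not_le] at h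
        refine hx0 ?_
        have : Real.smoothTransition (3 - ‖x‖ / R) = 0 := by
          apply Real.smoothTransition.zero_of_nonpos
          rw [sub_nonpos, le_div_iff₀ hR]; exact h.le
        simp [radialCutoff, this]
      · by_contra h
        rw [mem_ofPred_eq, not_le] at h
        refine hx0 ?_
        have : Real.smoothTransition (x (Fin.last n) / ‖x‖ / ε - 1) = 0 := by
          apply Real.smoothTransition.zero_of_nonpos
          rw [sub_nonpos, div_div, div_le_one (by positivity)]; linarith
        simp [radialCutoff, this]
    · refine (isClosed_le continuous_const continuous_norm).inter
        ((isClosed_le continuous_norm continuous_const).inter (isClosed_le ?_ ?_))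
      · fun_prop
      · fun_prop
  refine ⟨?_, ?_, ?_, ?_⟩
  · rw [contDiff_iff_contDiffAt]
    intro x
    by_cases hx : x = 0
    · subst hx
      have : radialField n R ε =ᶠ[𝓝 0] fun _ => 0 := by
        filter_upwards [Metric.ball_mem_nhds (0 : Space n) (show 0 < R / 4 by positivity)]
          with y hy
        rw [mem_ball_zero_iff] at hy
        simp [radialField, radialCutoff_eq_zero_of_norm_le hR ε hy.le]
      exact contDiffAt_const.congr_of_eventuallyEq this
    · exact ((contDiffAt_radialCutoff R ε hx).mul
        ((contDiffAt_norm ℝ hx).inv (norm_ne_zero_iff.2 hx))).smul contDiffAt_id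
  · refine HasCompactSupport.of_support_subset_isCompact
      (isCompact_closedBall (0 : Space n) (3 * R)) fun x hx => ?_
    have := (hsub (subset_tsupport _ hx)).2.1
    simpa using this
  · intro x hx
    obtain ⟨h1, -, h3⟩ := hsub hx
    have h0 : 0 < ‖x‖ := lt_of_lt_of_le (by positivity) h1
    exact lt_of_lt_of_le (by positivity : 0 < ε * ‖x‖) h3
  · intro x
    by_cases hx : x = 0
    · simp [radialField, hx]
    · have h0 : ‖x‖ ≠ 0 := norm_ne_zero_iff.2 hx
      rw [radialField, norm_smul, Real.norm_of_nonneg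
        (mul_nonneg (radialCutoff_nonneg _ _ _) (inv_nonneg.2 (norm_nonneg _))), mul_assoc,
        inv_mul_cancel₀ h0, mul_one]
      exact radialCutoff_le_one _ _ _

lemma radialCutoff_smul {R ε r : ℝ} (hr : 0 < r) (σ : UnitSphere n) :
    radialCutoff n R ε (r • (σ : Space n)) =
      Real.smoothTransition ((σ : Space n) (Fin.last n) / ε - 1) *
    (Real.smoothTransition (4 * r / R - 1) * Real.smoothTransition (3 - r / R)) := by
  rw [radialCutoff, norm_smul_unitSphere σ hr.le]
  simp [hr.ne']

end Cutoff

variable {n : ℕ} {φ : Space n → ℝ}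

lemma hasDerivAt_comp_smul {κ : Space n → ℝ} {r : ℝ} {x : Space n}
    (hκ : DifferentiableAt ℝ κ (r • x)) :
    HasDerivAt (fun s : ℝ => κ (s • x)) (fderiv ℝ κ (r • x) x) r := by
  have h : HasDerivAt (fun s : ℝ => s • x) x r := by
    simpa using (hasDerivAt_id r).smul_const x
  exact hκ.hasFDerivAt.comp_hasDerivAt r h

/-- The integral of the divergence over a half-ball is computed along rays by the fundamental
theorem of calculus, so that only the hemisphere contributes. -/
lemma integral_divergence_radialField (hc : Continuous φ)
    (hd : ContDiffOn ℝ 1 φ (halfSpace n)) {R ε : ℝ} (hR : 0 < R) (hε : 0 < ε) :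
    ∫ x in Metric.ball 0 R ∩ halfSpace n, divergence (fun y => φ y • radialField n R ε y) x =
      ∫ σ, radialDensity φ R σ * Real.smoothTransition ((σ : Space n) (Fin.last n) / ε - 1)
        ∂(hemi n) := by
  have hv := radialField_mem_testFields (n := n) hR hε
  set w : Space n → Space n := fun y => φ y • radialField n R ε y with hw
  have hwd : ContDiff ℝ 1 w := contDiff_weighted_field (isOpen_halfSpace n) hd hv
  have hwc : HasCompactSupport w :=
    HasCompactSupport.intro hv.2.1 fun x hx => by
      simp [hw, image_eq_zero_of_notMem_tsupport hx]
  have hdc := continuous_divergence hwd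
  have hdi : Integrable (divergence w) :=
    hdc.integrable_of_hasCompactSupport (hasCompactSupport_divergence hwc)
  rw [inter_comm, ← setIntegral_indicator Metric.isOpen_ball.measurableSet,
    integral_halfSpace_polar _ (hdi.indicator Metric.isOpen_ball.measurableSet).integrableOn]
  refine integral_congr_ae ?_
  filter_upwards [ae_restrict_mem (isOpen_upperSphere n).measurableSet] with σ hσ
  have e1 : ∀ r ∈ Ioi (0 : ℝ), r ^ n * (Metric.ball (0 : Space n) R).indicator (divergence w)
      (r • (σ : Space n)) =
      (Iio R).indicator (fun r => r ^ n * divergence w (r • (σ : Space n))) r := by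
    intro r hr
    by_cases h : r < R
    · rw [indicator_of_mem (by simpa [norm_smul_unitSphere σ (le_of_lt hr)] using h),
        indicator_of_mem (by simpa using h)]
    · rw [indicator_of_notMem (by simpa [norm_smul_unitSphere σ (le_of_lt hr)] using h),
        indicator_of_notMem (by simpa using h), mul_zero]
  rw [setIntegral_congr_fun measurableSet_Ioi e1, setIntegral_indicator measurableSet_Iio,
    Ioi_inter_Iio, ← integral_Ioc_eq_integral_Ioo, ← intervalIntegral.integral_of_le hR.le]
  set k : ℝ → ℝ := fun r => radialDensity φ r σ *
    (Real.smoothTransition ((σ : Space n) (Fin.last n) / ε - 1) *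
    (Real.smoothTransition (4 * r / R - 1) * Real.smoothTransition (3 - r / R))) with hk
  have hkc : Continuous k := by
    have h1 := Real.smoothTransition.continuous
    have h2 : Continuous fun r : ℝ => radialDensity φ r σ :=
      (continuous_radialDensity hc).comp (by fun_prop : Continuous fun r : ℝ => (r, σ))
    simp only [hk]
    fun_prop
  have hkd : ∀ r ∈ Ioo (0 : ℝ) R, HasDerivAt k (r ^ n * divergence w (r • (σ : Space n))) r := by
    intro r hr
    have hr0 : 0 < r := hr.1
    have hmem : r • (σ : Space n) ∈ halfSpace n := (smul_mem_halfSpace hr.1 _).2 hσ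
    have hne := ne_zero_of_mem_halfSpace hmem
    set κ : Space n → ℝ := fun y => φ y * (radialCutoff n R ε y * ‖y‖⁻¹) with hκ
    have hwκ : w = fun y => κ y • y := by
      ext1 y
      simp only [hw, hκ, radialField, smul_smul]
    have hκd : DifferentiableAt ℝ κ (r • (σ : Space n)) := by
      refine ContDiffAt.differentiableAt (n := 1) ?_ one_ne_zero
      exact (hd.contDiffAt ((isOpen_halfSpace n).mem_nhds hmem)).mul
        ((contDiffAt_radialCutoff R ε hne).mul
          ((contDiffAt_norm ℝ hne).inv (norm_ne_zero_iff.2 hne)))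
    have h1 := (hasDerivAt_pow (n + 1) r).mul (hasDerivAt_comp_smul hκd)
    have h2 : k =ᶠ[𝓝 r] (fun s => s ^ (n + 1)) * fun s => κ (s • (σ : Space n)) := by
      filter_upwards [isOpen_Ioi.mem_nhds hr0] with s hs
      have hs0 : s ≠ 0 := ne_of_gt hs
      simp only [hk, hκ, Pi.mul_apply, radialDensity, radialCutoff_smul hs,
        norm_smul_unitSphere σ (le_of_lt hs)]
      have e : s ^ (n + 1) * s⁻¹ = s ^ n := by
        rw [pow_succ, mul_assoc, mul_inv_cancel₀ hs0, mul_one]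
      rw [← e]
      ring
    refine (h1.congr_of_eventuallyEq h2).congr_deriv ?_
    rw [hwκ, divergence_smul_self hκd, map_smul]
    simp only [Nat.add_sub_cancel, smul_eq_mul]
    push_cast
    ring
  have hint : Continuous fun r : ℝ => r ^ n * divergence w (r • (σ : Space n)) := by fun_prop
  rw [intervalIntegral.integral_eq_sub_of_hasDerivAt_of_le hR.le hkc.continuousOn hkd
    (hint.intervalIntegrable _ _)]
  have h4 : Real.smoothTransition (4 * R / R - 1) = 1 :=
    Real.smoothTransition.one_of_one_le (by field_simp; norm_num)
  have h5 : Real.smoothTransition (3 - R / R) = 1 :=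
    Real.smoothTransition.one_of_one_le (by field_simp; norm_num)
  have h6 : Real.smoothTransition (4 * 0 / R - 1) = 0 :=
    Real.smoothTransition.zero_of_nonpos (by simp)
  simp only [hk, h4, h5, h6]
  ring

/-- The weighted area of the open hemisphere bounds the relative perimeter from below. The part of
the boundary on the hyperplane `x_N = 0` does not count, hence the cutoff near it. -/
lemma le_weightedPerimeter_halfBall (hc : Continuous φ)
    (hd : ContDiffOn ℝ 1 φ (halfSpace n)) {R : ℝ} (hR : 0 < R) :
    ((∫ σ, radialDensity φ R σ ∂(hemi n) : ℝ) : EReal) ≤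
      weightedPerimeter (halfSpace n) φ (Metric.ball 0 R ∩ halfSpace n) := by
  have hcR : Continuous fun σ : UnitSphere n => radialDensity φ R σ :=
    (continuous_radialDensity hc).comp (by fun_prop : Continuous fun σ : UnitSphere n => (R, σ))
  have hlim : Tendsto (fun j : ℕ => ∫ σ, radialDensity φ R σ *
      Real.smoothTransition ((σ : Space n) (Fin.last n) / (1 / ((j : ℝ) + 1)) - 1) ∂(hemi n)) atTop
      (𝓝 (∫ σ, radialDensity φ R σ ∂(hemi n))) := by
    refine tendsto_integral_of_dominated_convergence (fun σ => ‖radialDensity φ R σ‖) ?_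
      (integrable_continuous_hemi hcR).norm ?_ ?_
    · intro j
      have h1 := Real.smoothTransition.continuous
      exact Continuous.aestronglyMeasurable (by fun_prop)
    · refine fun j => Eventually.of_forall fun σ => ?_
      rw [norm_mul, Real.norm_of_nonneg (Real.smoothTransition.nonneg _)]
      exact mul_le_of_le_one_right (norm_nonneg _) (Real.smoothTransition.le_one _)
    · filter_upwards [ae_restrict_mem (isOpen_upperSphere n).measurableSet] with σ hσ
      refine tendsto_const_nhds.congr' ?_
      have hσ0 : 0 < (σ : Space n) (Fin.last n) := hσ
      filter_upwards [eventually_ge_atTop ⌈2 / (σ : Space n) (Fin.last n)⌉₊] with j hj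
      have hj' : 2 / (σ : Space n) (Fin.last n) ≤ j := Nat.ceil_le.1 hj
      rw [Real.smoothTransition.one_of_one_le, mul_one]
      rw [div_le_iff₀ hσ0] at hj'
      rw [div_div_eq_mul_div, div_one]
      nlinarith
  refine le_of_tendsto' ((continuous_coe_real_ereal.tendsto _).comp hlim) fun j => ?_
  have hj : (0 : ℝ) < 1 / ((j : ℝ) + 1) := by positivity
  simp only [Function.comp_apply]
  rw [← integral_divergence_radialField hc hd hR hj]
  exact le_iSup₂ (f := fun v (_ : v ∈ testFields (halfSpace n)) =>
    ((∫ x in Metric.ball 0 R ∩ halfSpace n, divergence (fun y => φ y • v y) x : ℝ) : EReal))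
    _ (radialField_mem_testFields hR hj)

end

/-! ### Perimeter and volume of star-shaped sets -/

section

/-- `G` is homogeneous of degree zero, of class `C¹` away from the origin, and so small that `R +
G` is an admissible radius function, with `L` a bound for its gradient away from the ball of
radius `R / 4`. -/
structure IsRadialPerturbation {n : ℕ} (R L : ℝ) (G : Space n → ℝ) : Prop where
  contDiffAt : ∀ x ≠ 0, ContDiffAt ℝ 1 G x
  homogeneous : ∀ r : ℝ, 0 < r → ∀ x, G (r • x) = G x
  abs_apply_le : ∀ x, |G x| ≤ R / 2
  norm_fderiv_le : ∀ x, R / 4 ≤ ‖x‖ → ‖fderiv ℝ G x‖ ≤ L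

/-- The part in the half space of the star-shaped set with radius function `R + G`. -/
def starSet {n : ℕ} (R : ℝ) (G : Space n → ℝ) : Set (Space n) :=
  {x | x ∈ halfSpace n ∧ ‖x‖ < R + G x}

variable {n : ℕ} {φ : Space n → ℝ} {R L : ℝ} {G : Space n → ℝ}

lemma starSet_zero : starSet R (0 : Space n → ℝ) = Metric.ball 0 R ∩ halfSpace n := by
  ext x
  simp [starSet, and_comm]

lemma isRadialPerturbation_zero (hR : 0 < R) :
    IsRadialPerturbation R 0 (0 : Space n → ℝ) where
  contDiffAt x _ := contDiffAt_const
  homogeneous r _ x := rfl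
  abs_apply_le x := by simp; positivity
  norm_fderiv_le x _ := by
    have : fderiv ℝ (0 : Space n → ℝ) x = 0 := by
      rw [show (0 : Space n → ℝ) = fun _ => 0 from rfl, fderiv_fun_const]; rfl
    simp [this]

lemma IsRadialPerturbation.isOpen_starSet (hG : IsRadialPerturbation R L G) :
    IsOpen (starSet R G) := by
  have hc : ContinuousOn (fun x : Space n => R + G x - ‖x‖) (halfSpace n) := fun x hx =>
    ((continuousAt_const.add (hG.contDiffAt x (ne_zero_of_mem_halfSpace hx)).continuousAt).sub
      continuous_norm.continuousAt).continuousWithinAt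
  have := hc.isOpen_inter_preimage (isOpen_halfSpace n) isOpen_Ioi (t := Ioi (0 : ℝ))
  convert this using 1
  ext x
  simp [starSet]

lemma IsRadialPerturbation.continuous_sphere (hG : IsRadialPerturbation R L G) :
    Continuous fun σ : UnitSphere n => G σ := by
  rw [continuous_iff_continuousAt]
  intro σ
  exact (hG.contDiffAt σ (unitSphere_ne_zero σ)).continuousAt.comp
    continuous_subtype_val.continuousAt

/-- Euler's relation for degree zero: the gradient is orthogonal to the radial direction. -/
lemma IsRadialPerturbation.fderiv_self (hG : IsRadialPerturbation R L G) {x : Space n}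
    (hx : x ≠ 0) : fderiv ℝ G x x = 0 := by
  have h1 : HasDerivAt (fun s : ℝ => G (s • x)) (fderiv ℝ G ((1 : ℝ) • x) x) 1 := by
    refine hasDerivAt_comp_smul ?_
    rw [one_smul]
    exact (hG.contDiffAt x hx).differentiableAt one_ne_zero
  have h2 : HasDerivAt (fun s : ℝ => G (s • x)) 0 1 := by
    refine (hasDerivAt_const (1 : ℝ) (G x)).congr_of_eventuallyEq ?_
    filter_upwards [isOpen_Ioi.mem_nhds (show (0 : ℝ) < 1 by norm_num)] with s hs
    exact hG.homogeneous s hs x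
  rw [one_smul] at h1
  exact h1.unique h2

lemma hasFDerivAt_norm_space {x : Space n} (hx : x ≠ 0) :
    HasFDerivAt (fun y : Space n => ‖y‖) (innerSL ℝ (‖x‖⁻¹ • x)) x := by
  have h := (hasStrictFDerivAt_norm_sq x).hasFDerivAt.sqrt
    (pow_ne_zero 2 (norm_ne_zero_iff.2 hx))
  simp only [Real.sqrt_sq (norm_nonneg _)] at h
  refine h.congr_fderiv ?_
  ext y
  simp
  ring

/-- By orthogonality `‖∇(‖x‖ - G)‖² = 1 + ‖∇G‖²`, so that the perturbation enters only to second
order. -/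
lemma IsRadialPerturbation.norm_fderiv_sub_le (hG : IsRadialPerturbation R L G)
    (hR : 0 < R) {x : Space n} (hx : R / 4 ≤ ‖x‖) :
    ‖fderiv ℝ (fun y => ‖y‖ - R - G y) x‖ ≤ 1 + L ^ 2 := by
  have hx0 : x ≠ 0 := norm_ne_zero_iff.1 (ne_of_gt (lt_of_lt_of_le (by positivity) hx))
  have hn : ‖x‖ ≠ 0 := norm_ne_zero_iff.2 hx0
  have hGd := ((hG.contDiffAt x hx0).differentiableAt one_ne_zero).hasFDerivAt
  set g : Space n := (InnerProductSpace.toDual ℝ (Space n)).symm (fderiv ℝ G x) with hg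
  have hgy : ∀ y, inner ℝ g y = fderiv ℝ G x y := fun y =>
    InnerProductSpace.toDual_symm_apply
  have hgn : ‖g‖ ≤ L := by
    rw [hg, LinearIsometryEquiv.norm_map]
    exact hG.norm_fderiv_le x hx
  have h1 : fderiv ℝ (fun y => ‖y‖ - R - G y) x = innerSL ℝ (‖x‖⁻¹ • x - g) := by
    have h := (((hasFDerivAt_norm_space hx0).sub_const R).sub hGd).fderiv
    refine Eq.trans h ?_
    ext y
    simp [hgy]
  rw [h1, innerSL_apply_norm]
  have h2 : inner ℝ (‖x‖⁻¹ • x) g = 0 := by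
    rw [real_inner_comm, inner_smul_right, hgy, hG.fderiv_self hx0, mul_zero]
  have h3 : ‖‖x‖⁻¹ • x - g‖ ^ 2 = 1 + ‖g‖ ^ 2 := by
    rw [norm_sub_sq_real, h2, norm_smul, norm_inv, norm_norm, inv_mul_cancel₀ hn]
    ring
  have h4 : ‖g‖ ^ 2 ≤ L ^ 2 := pow_le_pow_left₀ (norm_nonneg _) hgn 2
  refine (sq_le_sq₀ (norm_nonneg _) (by positivity)).1 ?_
  nlinarith [sq_nonneg L]

/-- A smooth approximation of the indicator function of `starSet R G`: it vanishes where `‖x‖ ≥ R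
+ G x` and equals one where `‖x‖ ≤ R + G x - h`. This choice makes the pointwise limit as `h → 0`
the indicator function of the open set, with no exceptional points. -/
def starCutoff (R h : ℝ) (G : Space n → ℝ) (x : Space n) : ℝ :=
  1 - Real.smoothTransition ((‖x‖ - R - G x) / h + 1)

lemma starCutoff_nonneg (R h : ℝ) (G : Space n → ℝ) (x : Space n) : 0 ≤ starCutoff R h G x :=
  sub_nonneg.2 (Real.smoothTransition.le_one _)

lemma starCutoff_le_one (R h : ℝ) (G : Space n → ℝ) (x : Space n) : starCutoff R h G x ≤ 1 :=
  sub_le_self _ (Real.smoothTransition.nonneg _)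

lemma IsRadialPerturbation.starCutoff_eq_one (hG : IsRadialPerturbation R L G)
    {h : ℝ} (hh : 0 < h) (hhR : h ≤ R / 4) {x : Space n} (hx : ‖x‖ ≤ R / 4) :
    starCutoff R h G x = 1 := by
  rw [starCutoff, Real.smoothTransition.zero_of_nonpos, sub_zero]
  have := (abs_le.1 (hG.abs_apply_le x)).1
  have : (‖x‖ - R - G x) / h ≤ -1 := by
    rw [div_le_iff₀ hh]; linarith
  linarith

lemma IsRadialPerturbation.contDiff_starCutoff (hG : IsRadialPerturbation R L G)
    {h : ℝ} (hh : 0 < h) (hhR : h ≤ R / 4) : ContDiff ℝ 1 (starCutoff R h G) := by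
  rw [contDiff_iff_contDiffAt]
  intro x
  by_cases hx : x = 0
  · subst hx
    refine (contDiffAt_const (c := (1 : ℝ))).congr_of_eventuallyEq ?_
    filter_upwards [Metric.ball_mem_nhds (0 : Space n) (show 0 < R / 4 by linarith)] with y hy
    exact hG.starCutoff_eq_one hh hhR (by simpa using (mem_ball_zero_iff.1 hy).le)
  · have hst : ContDiff ℝ 1 Real.smoothTransition := Real.smoothTransition.contDiff
    exact contDiffAt_const.sub (hst.contDiffAt.comp x
      (((((contDiffAt_norm ℝ hx).sub contDiffAt_const).sub (hG.contDiffAt x hx)).div_const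
        _).add contDiffAt_const))

lemma deriv_smoothTransition_nonneg (s : ℝ) : 0 ≤ deriv Real.smoothTransition s :=
  Real.smoothTransition.monotone.deriv_nonneg

lemma deriv_smoothTransition_eq_zero {s : ℝ} (hs : s < 0 ∨ 1 < s) :
    deriv Real.smoothTransition s = 0 := by
  rcases hs with hs | hs
  · have : Real.smoothTransition =ᶠ[𝓝 s] fun _ => 0 := by
      filter_upwards [isOpen_Iio.mem_nhds hs] with t ht
      exact Real.smoothTransition.zero_of_nonpos (le_of_lt ht)
    rw [this.deriv_eq, deriv_const]
  · have : Real.smoothTransition =ᶠ[𝓝 s] fun _ => 1 := by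
      filter_upwards [isOpen_Ioi.mem_nhds hs] with t ht
      exact Real.smoothTransition.one_of_one_le (le_of_lt ht)
    rw [this.deriv_eq, deriv_const]

lemma IsRadialPerturbation.norm_fderiv_starCutoff_le (hG : IsRadialPerturbation R L G)
    (hR : 0 < R) {h : ℝ} (hh : 0 < h) (hhR : h ≤ R / 4) (x : Space n) :
    ‖fderiv ℝ (starCutoff R h G) x‖ ≤
      deriv Real.smoothTransition ((‖x‖ - R - G x) / h + 1) / h * (1 + L ^ 2) := by
  have hst : ContDiff ℝ 1 Real.smoothTransition := Real.smoothTransition.contDiff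
  by_cases hx : ‖x‖ < R / 4
  · have : starCutoff R h G =ᶠ[𝓝 x] fun _ => 1 := by
      filter_upwards [(isOpen_lt continuous_norm continuous_const).mem_nhds hx] with y hy
      exact hG.starCutoff_eq_one hh hhR (le_of_lt hy)
    rw [this.fderiv_eq]
    have : 0 ≤ deriv Real.smoothTransition ((‖x‖ - R - G x) / h + 1) :=
      deriv_smoothTransition_nonneg _
    simp only [fderiv_fun_const, Pi.zero_apply, norm_zero]
    positivity
  · rw [not_lt] at hx
    have hx0 : x ≠ 0 := norm_ne_zero_iff.1 (ne_of_gt (lt_of_lt_of_le (by positivity) hx))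
    have hud : DifferentiableAt ℝ (fun y => ‖y‖ - R - G y) x :=
      (((contDiffAt_norm ℝ hx0).sub contDiffAt_const).sub (hG.contDiffAt x hx0)).differentiableAt
        one_ne_zero
    have h1 : HasFDerivAt (fun y => (‖y‖ - R - G y) / h + 1)
        (h⁻¹ • fderiv ℝ (fun y => ‖y‖ - R - G y) x) x := by
      simp only [div_eq_inv_mul]
      exact (hud.hasFDerivAt.const_mul h⁻¹).add_const 1
    have h2 := ((hst.differentiable one_ne_zero _).hasDerivAt.comp_hasFDerivAt x h1).const_sub 1
    have h3 : fderiv ℝ (starCutoff R h G) x = _ := h2.fderiv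
    rw [h3, norm_neg, norm_smul, norm_smul, Real.norm_of_nonneg (deriv_smoothTransition_nonneg _),
      norm_inv, Real.norm_of_nonneg hh.le, ← mul_assoc, ← div_eq_mul_inv]
    refine mul_le_mul_of_nonneg_left ?_ (div_nonneg (deriv_smoothTransition_nonneg _) hh.le)
    exact hG.norm_fderiv_sub_le hR hx

/-- Along each ray the derivative of the cutoff is a probability density supported in `[ρ - h,
ρ]`. -/
lemma lintegral_deriv_smoothTransition {ρ h : ℝ} (hh : 0 < h) (hρ : h ≤ ρ) :
    ∫⁻ r in Ioi (0 : ℝ), ENNReal.ofReal (deriv Real.smoothTransition ((r - ρ) / h + 1) / h) =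
      1 := by
  have hst : ContDiff ℝ 1 Real.smoothTransition := Real.smoothTransition.contDiff
  have hd : ∀ r : ℝ, HasDerivAt (fun r => Real.smoothTransition ((r - ρ) / h + 1))
      (deriv Real.smoothTransition ((r - ρ) / h + 1) / h) r := by
    intro r
    have h1 : HasDerivAt (fun r : ℝ => (r - ρ) / h + 1) (1 / h) r :=
      (((hasDerivAt_id r).sub_const ρ).div_const h).add_const 1
    have h2 := (hst.differentiable one_ne_zero _).hasDerivAt.comp r h1
    rwa [mul_one_div] at h2
  have hnn : ∀ r : ℝ, 0 ≤ deriv Real.smoothTransition ((r - ρ) / h + 1) / h := fun r =>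
    div_nonneg (deriv_smoothTransition_nonneg _) hh.le
  have hlim : Tendsto (fun r => Real.smoothTransition ((r - ρ) / h + 1)) atTop (𝓝 1) := by
    refine tendsto_const_nhds.congr' ?_
    filter_upwards [eventually_ge_atTop ρ] with r hr
    rw [Real.smoothTransition.one_of_one_le]
    have : 0 ≤ (r - ρ) / h := div_nonneg (by linarith) hh.le
    linarith
  have hint := integrableOn_Ioi_deriv_of_nonneg (hd 0).continuousAt.continuousWithinAt
    (fun r _ => hd r) (fun r _ => hnn r) hlim
  have hval := integral_Ioi_of_hasDerivAt_of_nonneg (hd 0).continuousAt.continuousWithinAt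
    (fun r _ => hd r) (fun r _ => hnn r) hlim
  have h0 : Real.smoothTransition ((0 - ρ) / h + 1) = 0 := by
    apply Real.smoothTransition.zero_of_nonpos
    have : (0 - ρ) / h ≤ -1 := by rw [div_le_iff₀ hh]; linarith
    linarith
  rw [← ofReal_integral_eq_lintegral_ofReal hint (Eventually.of_forall hnn), hval, h0]
  simp

lemma IsRadialPerturbation.continuous_radialDensity (hG : IsRadialPerturbation R L G)
    (hc : Continuous φ) : Continuous fun σ : UnitSphere n => radialDensity φ (R + G σ) σ :=
  (WeightedIso.continuous_radialDensity hc).comp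
    ((continuous_const.add hG.continuous_sphere).prodMk continuous_id)

lemma exists_radialDensity_le_add (hc : Continuous φ) (R : ℝ) {ε : ℝ} (hε : 0 < ε) :
    ∃ δ > 0, ∀ r ∈ Icc 0 (2 * R), ∀ ρ ∈ Icc 0 (2 * R), |r - ρ| < δ → ∀ σ : UnitSphere n,
      radialDensity φ r σ ≤ radialDensity φ ρ σ + ε := by
  have hK : IsCompact (Icc 0 (2 * R) ×ˢ (univ : Set (UnitSphere n))) :=
    isCompact_Icc.prod isCompact_univ
  have hu := hK.uniformContinuousOn_of_continuous
    (WeightedIso.continuous_radialDensity hc).continuousOn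
  obtain ⟨δ, hδ, h⟩ := Metric.uniformContinuousOn_iff.1 hu ε hε
  refine ⟨δ, hδ, fun r hr ρ hρ hrρ σ => ?_⟩
  have := h (r, σ) ⟨hr, mem_univ _⟩ (ρ, σ) ⟨hρ, mem_univ _⟩
    (by rw [Prod.dist_eq]; simpa [Real.dist_eq, hδ] using hrρ)
  rw [Real.dist_eq] at this
  linarith [(abs_lt.1 this).2]

lemma IsRadialPerturbation.lintegral_fderiv_starCutoff_le (hG : IsRadialPerturbation R L G)
    (hR : 0 < R) (hc : Continuous φ) (hpos : ∀ x ∈ halfSpace n, 0 < φ x) {ε : ℝ} (hε : 0 < ε) :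
    ∃ δ > 0, ∀ h, 0 < h → h ≤ δ → h ≤ R / 4 ∧
      ∫⁻ x in halfSpace n, ENNReal.ofReal (‖fderiv ℝ (starCutoff R h G) x‖ * φ x) ≤
        ENNReal.ofReal ((1 + L ^ 2) * (∫ σ, (radialDensity φ (R + G σ) σ + ε) ∂(hemi n))) := by
  obtain ⟨δ, hδ, hunif⟩ := exists_radialDensity_le_add (n := n) hc R hε
  refine ⟨min (δ / 2) (R / 4), by positivity, fun h hh hhδ => ?_⟩
  have hhR : h ≤ R / 4 := hhδ.trans (min_le_right _ _)
  have hhδ' : h < δ := lt_of_le_of_lt (hhδ.trans (min_le_left _ _)) (by linarith)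
  refine ⟨hhR, ?_⟩
  have hcf := (hG.contDiff_starCutoff hh hhR).continuous_fderiv one_ne_zero
  rw [lintegral_halfSpace_polar _ (by fun_prop), ← integral_const_mul,
    ofReal_integral_eq_lintegral_ofReal]
  rotate_left
  · exact (integrable_continuous_hemi ((hG.continuous_radialDensity hc).add
      continuous_const)).const_mul _
  · filter_upwards [ae_restrict_mem (isOpen_upperSphere n).measurableSet] with σ hσ
    have h1 := (abs_le.1 (hG.abs_apply_le σ)).1
    have h2 : 0 < R + G σ := by linarith
    have h3 := hpos _ ((smul_mem_halfSpace h2 _).2 hσ)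
    simp only [Pi.zero_apply, radialDensity]
    positivity
  refine lintegral_mono_ae ?_
  filter_upwards [ae_restrict_mem (isOpen_upperSphere n).measurableSet] with σ hσ
  set ρ := R + G σ with hρ
  have hρ1 : R / 2 ≤ ρ := by linarith [(abs_le.1 (hG.abs_apply_le σ)).1]
  have hρ2 : ρ ≤ 3 * R / 2 := by linarith [(abs_le.1 (hG.abs_apply_le σ)).2]
  have hρ0 : 0 < ρ := by linarith
  have hΦ : 0 ≤ radialDensity φ ρ σ :=
    mul_nonneg (pow_nonneg hρ0.le _) (hpos _ ((smul_mem_halfSpace hρ0 _).2 hσ)).le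
  calc ∫⁻ r in Ioi (0 : ℝ), ENNReal.ofReal (r ^ n) *
        ENNReal.ofReal (‖fderiv ℝ (starCutoff R h G) (r • (σ : Space n))‖ * φ (r • (σ : Space n)))
      ≤ ∫⁻ r in Ioi (0 : ℝ), ENNReal.ofReal ((1 + L ^ 2) * (radialDensity φ ρ σ + ε)) *
        ENNReal.ofReal (deriv Real.smoothTransition ((r - ρ) / h + 1) / h) := by
        refine setLIntegral_mono' measurableSet_Ioi fun r hr => ?_
        have hr0 : 0 < r := hr
        rw [← ENNReal.ofReal_mul (by positivity), ← ENNReal.ofReal_mul (by positivity)]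
        refine ENNReal.ofReal_le_ofReal ?_
        have hb := hG.norm_fderiv_starCutoff_le hR hh hhR (r • (σ : Space n))
        rw [norm_smul_unitSphere σ hr0.le, hG.homogeneous r hr0, sub_sub, ← hρ] at hb
        have hφr : 0 < φ (r • (σ : Space n)) := hpos _ ((smul_mem_halfSpace hr0 _).2 hσ)
        have e1 : r ^ n * (‖fderiv ℝ (starCutoff R h G) (r • (σ : Space n))‖ *
            φ (r • (σ : Space n))) =
            ‖fderiv ℝ (starCutoff R h G) (r • (σ : Space n))‖ * radialDensity φ r σ := by
          simp only [radialDensity]; ring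
        have hΦr : 0 ≤ radialDensity φ r σ := by
          simp only [radialDensity]; positivity
        rw [e1]
        refine (mul_le_mul_of_nonneg_right hb hΦr).trans ?_
        by_cases hz : (r - ρ) / h + 1 < 0 ∨ 1 < (r - ρ) / h + 1
        · rw [deriv_smoothTransition_eq_zero hz]
          simp
        · rw [not_or, not_lt, not_lt] at hz
          have hz1 : -h ≤ r - ρ := by
            have : -1 ≤ (r - ρ) / h := by linarith [hz.1]
            rw [le_div_iff₀ hh] at this; linarith
          have hz2 : r - ρ ≤ 0 := by
            have : (r - ρ) / h ≤ 0 := by linarith [hz.2]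
            rw [div_le_iff₀ hh] at this; linarith
          have := hunif r ⟨hr0.le, by linarith⟩ ρ ⟨hρ0.le, by linarith⟩
            (abs_lt.2 ⟨by linarith, by linarith⟩) σ
          have hdn : 0 ≤ deriv Real.smoothTransition ((r - ρ) / h + 1) / h :=
            div_nonneg (deriv_smoothTransition_nonneg _) hh.le
          calc _ = (deriv Real.smoothTransition ((r - ρ) / h + 1) / h * (1 + L ^ 2)) *
                radialDensity φ r σ := rfl
            _ ≤ (deriv Real.smoothTransition ((r - ρ) / h + 1) / h * (1 + L ^ 2)) *
                (radialDensity φ ρ σ + ε) := by gcongr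
            _ = _ := by ring
    _ = ENNReal.ofReal ((1 + L ^ 2) * (radialDensity φ ρ σ + ε)) := by
        rw [lintegral_const_mul' _ _ ENNReal.ofReal_ne_top,
          lintegral_deriv_smoothTransition hh (by linarith), mul_one]

lemma tendsto_starCutoff {x : Space n} (hx : x ∈ halfSpace n) {δ : ℝ} (hδ : 0 < δ) :
    Tendsto (fun k : ℕ => starCutoff R (δ / ((k : ℝ) + 1)) G x) atTop
      (𝓝 ((starSet R G).indicator 1 x)) := by
  refine tendsto_const_nhds.congr' ?_
  by_cases h : ‖x‖ < R + G x
  · rw [indicator_of_mem (show x ∈ starSet R G from ⟨hx, h⟩)]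
    filter_upwards [eventually_ge_atTop ⌈δ / (R + G x - ‖x‖)⌉₊] with k hk
    have hk' : δ / (R + G x - ‖x‖) ≤ k := Nat.ceil_le.1 hk
    rw [div_le_iff₀ (by linarith)] at hk'
    show (1 : ℝ) = 1 - Real.smoothTransition ((‖x‖ - R - G x) / (δ / ((k : ℝ) + 1)) + 1)
    rw [Real.smoothTransition.zero_of_nonpos, sub_zero]
    have : (‖x‖ - R - G x) / (δ / ((k : ℝ) + 1)) ≤ -1 := by
      rw [div_le_iff₀ (by positivity), neg_one_mul, le_neg, div_le_iff₀ (by positivity)]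
      nlinarith
    linarith
  · rw [indicator_of_notMem (fun h' : x ∈ starSet R G => h h'.2)]
    refine Eventually.of_forall fun k => ?_
    show (0 : ℝ) = 1 - Real.smoothTransition ((‖x‖ - R - G x) / (δ / ((k : ℝ) + 1)) + 1)
    rw [Real.smoothTransition.one_of_one_le, sub_self]
    have : 0 ≤ (‖x‖ - R - G x) / (δ / ((k : ℝ) + 1)) :=
      div_nonneg (by linarith) (by positivity)
    linarith

/-- Upper bound for the perimeters of a star-shaped set and of its complement in the half space.
-/
lemma IsRadialPerturbation.weightedPerimeter_le (hG : IsRadialPerturbation R L G)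
    (hR : 0 < R) (hc : Continuous φ) (hd : ContDiffOn ℝ 1 φ (halfSpace n))
    (hpos : ∀ x ∈ halfSpace n, 0 < φ x) :
    weightedPerimeter (halfSpace n) φ (starSet R G) ≤
        ((1 + L ^ 2) * (∫ σ, radialDensity φ (R + G σ) σ ∂(hemi n)) : ℝ) ∧
      weightedPerimeter (halfSpace n) φ (halfSpace n \ starSet R G) ≤
        ((1 + L ^ 2) * (∫ σ, radialDensity φ (R + G σ) σ ∂(hemi n)) : ℝ) := by
  have hint := integrable_continuous_hemi (hG.continuous_radialDensity hc)
  have hlim : Tendsto (fun ε : ℝ => (((1 + L ^ 2) *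
      (∫ σ, (radialDensity φ (R + G σ) σ + ε) ∂(hemi n)) : ℝ) : EReal)) (𝓝[>] 0)
      (𝓝 (((1 + L ^ 2) * (∫ σ, radialDensity φ (R + G σ) σ ∂(hemi n)) : ℝ) : EReal)) := by
    refine (continuous_coe_real_ereal.tendsto _).comp (tendsto_nhdsWithin_of_tendsto_nhds ?_)
    have e : ∀ ε : ℝ, ∫ σ, (radialDensity φ (R + G σ) σ + ε) ∂(hemi n) =
        (∫ σ, radialDensity φ (R + G σ) σ ∂(hemi n)) + (hemi n).real univ * ε := by
      intro ε
      rw [integral_add hint (integrable_const ε), integral_const, smul_eq_mul]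
    simp only [e]
    refine Continuous.tendsto' (by fun_prop) _ _ (by simp)
  have hnn : ∀ ε : ℝ, 0 < ε → 0 ≤ (1 + L ^ 2) *
      (∫ σ, (radialDensity φ (R + G σ) σ + ε) ∂(hemi n)) := by
    intro ε hε
    refine mul_nonneg (by positivity) (integral_nonneg_of_ae ?_)
    filter_upwards [ae_restrict_mem (isOpen_upperSphere n).measurableSet] with σ hσ
    have h1 := (abs_le.1 (hG.abs_apply_le σ)).1
    have h2 : 0 < R + G σ := by linarith
    have h3 := hpos _ ((smul_mem_halfSpace h2 _).2 hσ)
    simp only [Pi.zero_apply, radialDensity]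
    positivity
  have hstep : ∀ (k : ℕ) (δ : ℝ), 0 < δ → 0 < δ / ((k : ℝ) + 1) ∧ δ / ((k : ℝ) + 1) ≤ δ :=
    fun k δ hδ => ⟨by positivity, div_le_self hδ.le (by simp)⟩
  constructor
  · refine ge_of_tendsto hlim (eventually_nhdsWithin_of_forall fun ε hε => ?_)
    obtain ⟨δ, hδ, hle⟩ := hG.lintegral_fderiv_starCutoff_le hR hc hpos hε
    refine weightedPerimeter_le_of_approx (isOpen_halfSpace n) hd (fun x hx => (hpos x hx).le)
      hG.isOpen_starSet.measurableSet (ζ := fun k => starCutoff R (δ / ((k : ℝ) + 1)) G)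
      (fun k => hG.contDiff_starCutoff (hstep k δ hδ).1
        (hle _ (hstep k δ hδ).1 (hstep k δ hδ).2).1)
      (fun k x => starCutoff_nonneg _ _ _ _) (fun k x => starCutoff_le_one _ _ _ _)
      (fun x hx => tendsto_starCutoff hx hδ) (hnn ε hε)
      (fun k => (hle _ (hstep k δ hδ).1 (hstep k δ hδ).2).2)
  · refine ge_of_tendsto hlim (eventually_nhdsWithin_of_forall fun ε hε => ?_)
    obtain ⟨δ, hδ, hle⟩ := hG.lintegral_fderiv_starCutoff_le hR hc hpos hε
    refine weightedPerimeter_le_of_approx (isOpen_halfSpace n) hd (fun x hx => (hpos x hx).le)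
      ((isOpen_halfSpace n).measurableSet.diff hG.isOpen_starSet.measurableSet)
      (ζ := fun k x => 1 - starCutoff R (δ / ((k : ℝ) + 1)) G x)
      (fun k => contDiff_const.sub (hG.contDiff_starCutoff (hstep k δ hδ).1
        (hle _ (hstep k δ hδ).1 (hstep k δ hδ).2).1))
      (fun k x => sub_nonneg.2 (starCutoff_le_one _ _ _ _))
      (fun k x => sub_le_self _ (starCutoff_nonneg _ _ _ _))
      (fun x hx => ?_) (hnn ε hε)
      (fun k => ?_)
    · have := (tendsto_starCutoff (R := R) (G := G) hx hδ).const_sub 1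
      convert this using 2
      by_cases h : x ∈ starSet R G <;> simp [h, hx]
    · simp only [fderiv_const_sub, norm_neg]
      exact (hle _ (hstep k δ hδ).1 (hstep k δ hδ).2).2

lemma IsRadialPerturbation.weightedVolume_starSet (hG : IsRadialPerturbation R L G)
    (hR : 0 < R) (hc : Continuous φ) (hpos : ∀ x ∈ halfSpace n, 0 < φ x) :
    weightedVolume φ (starSet R G) =
      ENNReal.ofReal (∫ σ, (∫ r in (0 : ℝ)..(R + G σ), radialDensity φ r σ) ∂(hemi n)) := by
  have hm := hG.isOpen_starSet.measurableSet
  have hcont : Continuous fun σ : UnitSphere n =>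
      ∫ r in (0 : ℝ)..(R + G σ), radialDensity φ r σ :=
    intervalIntegral.continuous_parametric_intervalIntegral_of_continuous
      (f := fun (σ : UnitSphere n) r => radialDensity φ r σ)
      ((WeightedIso.continuous_radialDensity hc).comp continuous_swap)
      (continuous_const.add hG.continuous_sphere)
  have hρ0 : ∀ σ : UnitSphere n, 0 ≤ R + G σ := fun σ => by
    linarith [(abs_le.1 (hG.abs_apply_le σ)).1]
  have hΦ : ∀ σ ∈ upperSphere n, ∀ r : ℝ, 0 < r → 0 ≤ radialDensity φ r σ := fun σ hσ r hr =>
    mul_nonneg (pow_nonneg hr.le _) (hpos _ ((smul_mem_halfSpace hr _).2 hσ)).le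
  have h1 : weightedVolume φ (starSet R G) =
      ∫⁻ x in halfSpace n, (starSet R G).indicator (fun x => ENNReal.ofReal (φ x)) x := by
    rw [weightedVolume, setLIntegral_indicator hm,
      inter_eq_self_of_subset_left (fun x (hx : x ∈ starSet R G) => hx.1)]
  rw [h1, lintegral_halfSpace_polar _ ((by fun_prop : Measurable
    fun x => ENNReal.ofReal (φ x)).indicator hm), ofReal_integral_eq_lintegral_ofReal
    (integrable_continuous_hemi hcont)]
  · refine lintegral_congr_ae ?_
    filter_upwards [ae_restrict_mem (isOpen_upperSphere n).measurableSet] with σ hσ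
    have e1 : ∀ r ∈ Ioi (0 : ℝ), ENNReal.ofReal (r ^ n) *
        (starSet R G).indicator (fun x => ENNReal.ofReal (φ x)) (r • (σ : Space n)) =
        (Iio (R + G σ)).indicator (fun r => ENNReal.ofReal (radialDensity φ r σ)) r := by
      intro r hr
      have hr0 : 0 < r := hr
      have hmem : r • (σ : Space n) ∈ starSet R G ↔ r ∈ Iio (R + G σ) := by
        simp only [starSet, mem_ofPred_eq, smul_mem_halfSpace hr0, norm_smul_unitSphere σ hr0.le,
          hG.homogeneous r hr0, mem_Iio]
        exact ⟨fun h => h.2, fun h => ⟨hσ, h⟩⟩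
      by_cases h : r ∈ Iio (R + G σ)
      · rw [indicator_of_mem h, indicator_of_mem (hmem.2 h), ← ENNReal.ofReal_mul (by positivity)]
        rfl
      · rw [indicator_of_notMem h, indicator_of_notMem (fun h' => h (hmem.1 h')), mul_zero]
    have hci : Continuous fun r : ℝ => radialDensity φ r σ :=
      (WeightedIso.continuous_radialDensity hc).comp (by fun_prop : Continuous fun r : ℝ => (r, σ))
    rw [setLIntegral_congr_fun measurableSet_Ioi e1, setLIntegral_indicator measurableSet_Iio,
      inter_comm, Ioi_inter_Iio, intervalIntegral.integral_of_le (hρ0 σ),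
      integral_Ioc_eq_integral_Ioo, ofReal_integral_eq_lintegral_ofReal]
    · exact ((hci.intervalIntegrable 0 (R + G σ)).1).mono_set Ioo_subset_Ioc_self
    · filter_upwards [ae_restrict_mem measurableSet_Ioo] with r hr
      exact hΦ σ hσ r hr.1
  · filter_upwards [ae_restrict_mem (isOpen_upperSphere n).measurableSet] with σ hσ
    rw [Pi.zero_apply, intervalIntegral.integral_of_le (hρ0 σ)]
    exact setIntegral_nonneg measurableSet_Ioc fun r hr => hΦ σ hσ r hr.1

end

/-! ### Radial variation of the density and bumps on the sphere -/

section

/-- Half-balls centred at the origin have the least weighted perimeter among the Borel sets of the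
same weighted volume. -/
def HalfBallsMinimize {n : ℕ} (φ : Space n → ℝ) : Prop :=
  ∀ R : ℝ, 0 < R → ∀ M : Set (Space n), MeasurableSet M → M ⊆ halfSpace n →
    weightedVolume φ M = weightedVolume φ (Metric.ball 0 R ∩ halfSpace n) →
    weightedPerimeter (halfSpace n) φ (Metric.ball 0 R ∩ halfSpace n) ≤
      weightedPerimeter (halfSpace n) φ M

/-- The radial logarithmic derivative `x · ∇φ(x) / φ(x)`. The weighted mean curvature of the
hemisphere of radius `R` at `x` is `(n + radialLogDeriv φ x) / R`. -/
def radialLogDeriv {n : ℕ} (φ : Space n → ℝ) (x : Space n) : ℝ := fderiv ℝ φ x x / φ x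

variable {n : ℕ} {φ : Space n → ℝ} {R L : ℝ} {G : Space n → ℝ}

lemma continuous_radialDensity_left (hc : Continuous φ) (σ : UnitSphere n) :
    Continuous fun r : ℝ => radialDensity φ r σ :=
  (continuous_radialDensity hc).comp (by fun_prop : Continuous fun r : ℝ => (r, σ))

lemma continuous_radialDensity_right (hc : Continuous φ) (r : ℝ) :
    Continuous fun σ : UnitSphere n => radialDensity φ r σ :=
  (continuous_radialDensity hc).comp (by fun_prop : Continuous fun σ : UnitSphere n => (r, σ))

/-- The isoperimetric inequality for half-balls, tested with a star-shaped set of the same volume.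
-/
lemma HalfBallsMinimize.integral_le (hiso : HalfBallsMinimize φ) (hc : Continuous φ)
    (hd : ContDiffOn ℝ 1 φ (halfSpace n)) (hpos : ∀ x ∈ halfSpace n, 0 < φ x) (hR : 0 < R)
    (hG : IsRadialPerturbation R L G)
    (hvol : ∫ σ : UnitSphere n, (∫ r in (0 : ℝ)..(R + G σ), radialDensity φ r σ) ∂(hemi n) =
      ∫ σ : UnitSphere n, (∫ r in (0 : ℝ)..R, radialDensity φ r σ) ∂(hemi n)) :
    ∫ σ, radialDensity φ R σ ∂(hemi n) ≤
      (1 + L ^ 2) * ∫ σ, radialDensity φ (R + G σ) σ ∂(hemi n) := by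
  have h0 := (isRadialPerturbation_zero (n := n) hR).weightedVolume_starSet hR hc hpos
  simp only [Pi.zero_apply, add_zero, starSet_zero] at h0
  have h1 := hiso R hR (starSet R G) hG.isOpen_starSet.measurableSet (fun x hx => hx.1)
    (by rw [hG.weightedVolume_starSet hR hc hpos, hvol, h0])
  have h2 := (le_weightedPerimeter_halfBall hc hd hR).trans
    (h1.trans (hG.weightedPerimeter_le hR hc hd hpos).1)
  exact EReal.coe_le_coe_iff.1 h2

lemma continuousOn_radialLogDeriv (hd : ContDiffOn ℝ 1 φ (halfSpace n))
    (hpos : ∀ x ∈ halfSpace n, 0 < φ x) : ContinuousOn (radialLogDeriv φ) (halfSpace n) := by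
  have h1 := hd.continuousOn_fderiv_of_isOpen (isOpen_halfSpace n) le_rfl
  exact (h1.clm_apply continuousOn_id).div hd.continuousOn fun x hx => (hpos x hx).ne'

lemma hasDerivAt_radialDensity (hd : ContDiffOn ℝ 1 φ (halfSpace n))
    (hpos : ∀ x ∈ halfSpace n, 0 < φ x) {σ : UnitSphere n} (hσ : σ ∈ upperSphere n) {r : ℝ}
    (hr : 0 < r) :
    HasDerivAt (fun r => radialDensity φ r σ)
      ((n + radialLogDeriv φ (r • (σ : Space n))) / r * radialDensity φ r σ) r := by
  have hmem : r • (σ : Space n) ∈ halfSpace n := (smul_mem_halfSpace hr _).2 hσ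
  have h1 := (hasDerivAt_pow n r).mul (hasDerivAt_comp_smul (x := (σ : Space n))
    ((hd.contDiffAt ((isOpen_halfSpace n).mem_nhds hmem)).differentiableAt one_ne_zero))
  refine h1.congr_deriv ?_
  have h2 := (hpos _ hmem).ne'
  have h3 : (n : ℝ) * r ^ (n - 1) = n * r ^ n / r := by
    rcases n with _ | m
    · simp
    · rw [Nat.add_sub_cancel, pow_succ]; field_simp
  rw [h3, radialLogDeriv, radialDensity, map_smul, smul_eq_mul]
  field_simp

/-- Where the mean curvature is at most `κ`, moving outwards changes the area by at most `κ` times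
the volume gained. -/
lemma sub_le_mul_integral_radialDensity (hc : Continuous φ)
    (hd : ContDiffOn ℝ 1 φ (halfSpace n)) (hpos : ∀ x ∈ halfSpace n, 0 < φ x)
    {σ : UnitSphere n} (hσ : σ ∈ upperSphere n) {a b κ : ℝ} (ha : 0 < a) (hab : a ≤ b)
    (hκ : ∀ r ∈ Icc a b, (n + radialLogDeriv φ (r • (σ : Space n))) / r ≤ κ) :
    radialDensity φ b σ - radialDensity φ a σ ≤ κ * ∫ r in a..b, radialDensity φ r σ := by
  have hcr := continuous_radialDensity_left hc σ
  have hder : ∀ r ∈ Icc a b, HasDerivAt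
      (fun s => κ * (∫ r in a..s, radialDensity φ r σ) - radialDensity φ s σ)
      (κ * radialDensity φ r σ -
        (n + radialLogDeriv φ (r • (σ : Space n))) / r * radialDensity φ r σ) r := fun r hr =>
    ((hcr.integral_hasStrictDerivAt a r).hasDerivAt.const_mul κ).sub
      (hasDerivAt_radialDensity hd hpos hσ (ha.trans_le hr.1))
  have hmono : MonotoneOn
      (fun s => κ * (∫ r in a..s, radialDensity φ r σ) - radialDensity φ s σ) (Icc a b) := by
    refine monotoneOn_of_deriv_nonneg (convex_Icc a b)
      (fun r hr => (hder r hr).continuousAt.continuousWithinAt)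
      (fun r hr => (hder r (interior_subset hr)).differentiableAt.differentiableWithinAt)
      fun r hr => ?_
    have hr' := interior_subset hr
    rw [(hder r hr').deriv, ← sub_mul]
    have hr0 : 0 < r := ha.trans_le hr'.1
    exact mul_nonneg (sub_nonneg.2 (hκ r hr')) (mul_nonneg (pow_nonneg hr0.le _)
      (hpos _ ((smul_mem_halfSpace hr0 _).2 hσ)).le)
  have := hmono (left_mem_Icc.2 hab) (right_mem_Icc.2 hab) hab
  simp only [intervalIntegral.integral_same, mul_zero] at this
  linarith

/-- Where the mean curvature is at least `κ`, moving inwards lowers the area by at least `κ` times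
the volume lost. -/
lemma mul_integral_radialDensity_le_sub (hc : Continuous φ)
    (hd : ContDiffOn ℝ 1 φ (halfSpace n)) (hpos : ∀ x ∈ halfSpace n, 0 < φ x)
    {σ : UnitSphere n} (hσ : σ ∈ upperSphere n) {a b κ : ℝ} (ha : 0 < a) (hab : a ≤ b)
    (hκ : ∀ r ∈ Icc a b, κ ≤ (n + radialLogDeriv φ (r • (σ : Space n))) / r) :
    κ * ∫ r in a..b, radialDensity φ r σ ≤ radialDensity φ b σ - radialDensity φ a σ := by
  have hcr := continuous_radialDensity_left hc σ
  have hder : ∀ r ∈ Icc a b, HasDerivAt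
      (fun s => radialDensity φ s σ - κ * (∫ r in a..s, radialDensity φ r σ))
      ((n + radialLogDeriv φ (r • (σ : Space n))) / r * radialDensity φ r σ -
        κ * radialDensity φ r σ) r := fun r hr =>
    (hasDerivAt_radialDensity hd hpos hσ (ha.trans_le hr.1)).sub
      ((hcr.integral_hasStrictDerivAt a r).hasDerivAt.const_mul κ)
  have hmono : MonotoneOn
      (fun s => radialDensity φ s σ - κ * (∫ r in a..s, radialDensity φ r σ)) (Icc a b) := by
    refine monotoneOn_of_deriv_nonneg (convex_Icc a b)
      (fun r hr => (hder r hr).continuousAt.continuousWithinAt)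
      (fun r hr => (hder r (interior_subset hr)).differentiableAt.differentiableWithinAt)
      fun r hr => ?_
    have hr' := interior_subset hr
    rw [(hder r hr').deriv, ← sub_mul]
    have hr0 : 0 < r := ha.trans_le hr'.1
    exact mul_nonneg (sub_nonneg.2 (hκ r hr')) (mul_nonneg (pow_nonneg hr0.le _)
      (hpos _ ((smul_mem_halfSpace hr0 _).2 hσ)).le)
  have := hmono (left_mem_Icc.2 hab) (right_mem_Icc.2 hab) hab
  simp only [intervalIntegral.integral_same, mul_zero] at this
  linarith

/-- The gradient of a function homogeneous of degree zero is homogeneous of degree `-1`, hence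
bounded away from the origin. -/
lemma exists_norm_fderiv_le {g : Space n → ℝ} (hg : ∀ x ≠ 0, ContDiffAt ℝ 1 g x)
    (hh : ∀ r : ℝ, 0 < r → ∀ x, g (r • x) = g x) {c : ℝ} (hc : 0 < c) :
    ∃ C : ℝ, 0 ≤ C ∧ ∀ x, c ≤ ‖x‖ → ‖fderiv ℝ g x‖ ≤ C := by
  have hcont : ContinuousOn (fun x => ‖fderiv ℝ g x‖) (Metric.sphere (0 : Space n) 1) := by
    intro x hx
    have hx0 : x ≠ 0 := unitSphere_ne_zero ⟨x, hx⟩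
    have h := ((hg x hx0).fderiv_right (m := 0) (by simp)).continuousAt
    exact h.norm.continuousWithinAt
  obtain ⟨C, hC⟩ := (isCompact_sphere (0 : Space n) 1).bddAbove_image hcont
  refine ⟨max C 0 / c, by positivity, fun x hx => ?_⟩
  have hx0 : 0 < ‖x‖ := hc.trans_le hx
  have hfun : g = fun y => g (‖x‖⁻¹ • y) := by
    ext y; exact (hh _ (inv_pos.2 hx0) y).symm
  have h1 : fderiv ℝ g x = ‖x‖⁻¹ • fderiv ℝ g (‖x‖⁻¹ • x) := by
    conv_lhs => rw [hfun]
    exact fderiv_comp_smul _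
  have hmem : ‖x‖⁻¹ • x ∈ Metric.sphere (0 : Space n) 1 := by
    simp [norm_smul, hx0.ne']
  have h2 : ‖fderiv ℝ g (‖x‖⁻¹ • x)‖ ≤ C := hC (mem_image_of_mem _ hmem)
  rw [h1, norm_smul, norm_inv, norm_norm, ← div_eq_inv_mul]
  exact div_le_div₀ (le_max_right _ _) (h2.trans (le_max_left _ _)) hc hx

section Bump

/-- A bump function homogeneous of degree zero, supported in the cone over the spherical cap `⟪p,
σ⟫ ≥ 1 - δ` and equal to one on the axis. -/
def capBump (p : UnitSphere n) (δ : ℝ) (x : Space n) : ℝ :=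
  Real.smoothTransition ((inner ℝ (p : Space n) x / ‖x‖ - (1 - δ)) / δ)

variable (p : UnitSphere n) {δ : ℝ}

lemma capBump_nonneg (x : Space n) : 0 ≤ capBump p δ x := Real.smoothTransition.nonneg _

lemma capBump_le_one (x : Space n) : capBump p δ x ≤ 1 := Real.smoothTransition.le_one _

lemma contDiffAt_capBump {x : Space n} (hx : x ≠ 0) : ContDiffAt ℝ 1 (capBump p δ) x := by
  have hst : ContDiff ℝ 1 Real.smoothTransition := Real.smoothTransition.contDiff
  refine hst.contDiffAt.comp x ?_
  have h1 : ContDiffAt ℝ 1 (fun y : Space n => inner ℝ (p : Space n) y) x :=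
    contDiffAt_const.inner ℝ contDiffAt_id
  exact ((h1.div (contDiffAt_norm ℝ hx) (norm_ne_zero_iff.2 hx)).sub contDiffAt_const).div_const _

lemma capBump_smul {r : ℝ} (hr : 0 < r) (x : Space n) :
    capBump p δ (r • x) = capBump p δ x := by
  simp only [capBump]
  rw [inner_smul_right, norm_smul, Real.norm_of_nonneg hr.le, mul_div_mul_left _ _ hr.ne']

lemma lt_inner_of_capBump_ne_zero (hδ : 0 < δ) {σ : UnitSphere n} (h : capBump p δ σ ≠ 0) :
    1 - δ < inner ℝ (p : Space n) σ := by
  by_contra hle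
  refine h (Real.smoothTransition.zero_of_nonpos ?_)
  rw [norm_unitSphere, div_one]
  exact div_nonpos_of_nonpos_of_nonneg (by linarith) hδ.le

lemma capBump_self (hδ : 0 < δ) : capBump p δ p = 1 := by
  refine Real.smoothTransition.one_of_one_le ?_
  rw [real_inner_self_eq_norm_sq, norm_unitSphere]
  rw [le_div_iff₀ hδ]; linarith

lemma continuous_capBump : Continuous fun σ : UnitSphere n => capBump p δ σ := by
  rw [continuous_iff_continuousAt]
  intro σ
  exact (contDiffAt_capBump p (unitSphere_ne_zero σ)).continuousAt.comp
    continuous_subtype_val.continuousAt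

lemma integral_capBump_pos (hδ : 0 < δ)
    (hsub : ∀ σ : UnitSphere n, 1 - δ < inner ℝ (p : Space n) σ → σ ∈ upperSphere n) :
    0 < ∫ σ : UnitSphere n, capBump p δ σ ∂(hemi n) := by
  rw [hemi, setIntegral_eq_integral_of_forall_compl_eq_zero]
  · refine (continuous_capBump p).integral_pos_of_hasCompactSupport_nonneg_nonzero
      (HasCompactSupport.of_compactSpace _) (fun σ => capBump_nonneg p _) (x := p) ?_
    rw [capBump_self p hδ]; exact one_ne_zero
  · intro σ hσ
    by_contra h
    exact hσ (hsub σ (lt_inner_of_capBump_ne_zero p hδ h))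

lemma exists_cap_subset {U : Set (Space n)} (hU : IsOpen U) (hR : 0 < R)
    (hp : R • (p : Space n) ∈ U) :
    ∃ δ > 0, ∀ σ : UnitSphere n, 1 - δ < inner ℝ (p : Space n) σ →
      ∀ r, |r - R| ≤ δ → r • (σ : Space n) ∈ U := by
  obtain ⟨η, hη, hball⟩ := Metric.isOpen_iff.1 hU _ hp
  refine ⟨min (η / 2) (η ^ 2 / (8 * R ^ 2)), by positivity, fun σ hσ r hr => hball ?_⟩
  have h1 : |r - R| ≤ η / 2 := hr.trans (min_le_left _ _)
  have h2 : ‖(σ : Space n) - p‖ ^ 2 < (η / (2 * R)) ^ 2 := by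
    rw [norm_sub_sq_real, norm_unitSphere, norm_unitSphere, real_inner_comm]
    have : min (η / 2) (η ^ 2 / (8 * R ^ 2)) ≤ η ^ 2 / (8 * R ^ 2) := min_le_right _ _
    have e : (η / (2 * R)) ^ 2 = 2 * (η ^ 2 / (8 * R ^ 2)) := by field_simp; norm_num
    rw [e]; linarith
  have h3 : ‖(σ : Space n) - p‖ < η / (2 * R) := lt_of_pow_lt_pow_left₀ 2 (by positivity) h2
  rw [mem_ball_iff_norm]
  have e : r • (σ : Space n) - R • (p : Space n) =
      (r - R) • (σ : Space n) + R • ((σ : Space n) - p) := by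
    rw [sub_smul, smul_sub]; abel
  rw [e]
  refine (norm_add_le _ _).trans_lt ?_
  rw [norm_smul, norm_smul, norm_unitSphere, mul_one, Real.norm_eq_abs, Real.norm_of_nonneg hR.le]
  have h4 : R * ‖(σ : Space n) - p‖ < η / 2 := by
    calc R * ‖(σ : Space n) - p‖ < R * (η / (2 * R)) := by gcongr
      _ = η / 2 := by field_simp
  linarith

end Bump

lemma isRadialPerturbation_sub {g₁ g₂ : Space n → ℝ} {C t τ : ℝ}
    (hg₁ : ∀ x ≠ 0, ContDiffAt ℝ 1 g₁ x) (hg₂ : ∀ x ≠ 0, ContDiffAt ℝ 1 g₂ x)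
    (hh₁ : ∀ r : ℝ, 0 < r → ∀ x, g₁ (r • x) = g₁ x)
    (hh₂ : ∀ r : ℝ, 0 < r → ∀ x, g₂ (r • x) = g₂ x)
    (h₁ : ∀ x, g₁ x ∈ Icc (0 : ℝ) 1) (h₂ : ∀ x, g₂ x ∈ Icc (0 : ℝ) 1)
    (hC₁ : ∀ x, R / 4 ≤ ‖x‖ → ‖fderiv ℝ g₁ x‖ ≤ C)
    (hC₂ : ∀ x, R / 4 ≤ ‖x‖ → ‖fderiv ℝ g₂ x‖ ≤ C) (hR : 0 < R)
    (ht : 0 ≤ t) (hτ : 0 ≤ τ) (htR : t ≤ R / 2) (hτR : τ ≤ R / 2) :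
    IsRadialPerturbation R (C * (t + τ)) (fun x => t * g₁ x - τ * g₂ x) where
  contDiffAt x hx := (contDiffAt_const.mul (hg₁ x hx)).sub (contDiffAt_const.mul (hg₂ x hx))
  homogeneous r hr x := by simp only [hh₁ r hr, hh₂ r hr]
  abs_apply_le x := by
    obtain ⟨a1, a2⟩ := h₁ x
    obtain ⟨b1, b2⟩ := h₂ x
    rw [abs_le]
    constructor <;> nlinarith
  norm_fderiv_le x hx := by
    have hx0 : x ≠ 0 := norm_ne_zero_iff.1 (ne_of_gt (lt_of_lt_of_le (by positivity) hx))
    have e1 := ((hg₁ x hx0).differentiableAt one_ne_zero).hasFDerivAt.const_mul t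
    have e2 := ((hg₂ x hx0).differentiableAt one_ne_zero).hasFDerivAt.const_mul τ
    have e3 : fderiv ℝ (fun x => t * g₁ x - τ * g₂ x) x = _ := (e1.sub e2).fderiv
    rw [e3]
    refine (norm_sub_le _ _).trans ?_
    rw [norm_smul, norm_smul, Real.norm_of_nonneg ht, Real.norm_of_nonneg hτ]
    nlinarith [hC₁ x hx, hC₂ x hx]

lemma exists_radialDensity_bound (hc : Continuous φ) (R : ℝ) :
    ∃ C : ℝ, 0 ≤ C ∧ ∀ r ∈ Icc 0 (2 * R), ∀ σ : UnitSphere n, radialDensity φ r σ ≤ C := by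
  have hK : IsCompact (Icc 0 (2 * R) ×ˢ (univ : Set (UnitSphere n))) :=
    isCompact_Icc.prod isCompact_univ
  obtain ⟨C, hC⟩ := hK.bddAbove_image (continuous_radialDensity hc).continuousOn
  exact ⟨max C 0, le_max_right _ _, fun r hr σ =>
    (hC (mem_image_of_mem _ (mk_mem_prod hr (mem_univ σ)))).trans (le_max_left _ _)⟩

lemma isOpen_inter_preimage_radialLogDeriv (hd : ContDiffOn ℝ 1 φ (halfSpace n))
    (hpos : ∀ x ∈ halfSpace n, 0 < φ x) (V : Set (ℝ × ℝ)) (hV : IsOpen V) :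
    IsOpen (halfSpace n ∩ (fun x : Space n =>
      ((n + radialLogDeriv φ x) / ‖x‖, ‖x‖ ^ n * φ x)) ⁻¹' V) := by
  refine ContinuousOn.isOpen_inter_preimage ?_ (isOpen_halfSpace n) hV
  refine ContinuousOn.prodMk ?_ ?_
  · exact (continuousOn_const.add (continuousOn_radialLogDeriv hd hpos)).div
      continuous_norm.continuousOn fun x hx => norm_ne_zero_iff.2 (ne_zero_of_mem_halfSpace hx)
  · exact (continuous_norm.pow n).continuousOn.mul hd.continuousOn

end

/-! ### The first variation of perimeter under a volume constraint -/

section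

variable {n : ℕ} {φ : Space n → ℝ} {R : ℝ}

lemma exists_cap_forall_mem (hd : ContDiffOn ℝ 1 φ (halfSpace n))
    (hpos : ∀ x ∈ halfSpace n, 0 < φ x) (hR : 0 < R) {p : UnitSphere n} (hp : p ∈ upperSphere n)
    {V : Set (ℝ × ℝ)} (hV : IsOpen V)
    (hpV : ((n + radialLogDeriv φ (R • (p : Space n))) / R, radialDensity φ R p) ∈ V) :
    ∃ δ > 0, δ ≤ R / 2 ∧ ∀ σ : UnitSphere n, 1 - δ < inner ℝ (p : Space n) σ →
      σ ∈ upperSphere n ∧ ∀ r, |r - R| ≤ δ →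
        ((n + radialLogDeriv φ (r • (σ : Space n))) / r, radialDensity φ r σ) ∈ V := by
  obtain ⟨δ, hδ, h⟩ := exists_cap_subset p
    (isOpen_inter_preimage_radialLogDeriv hd hpos V hV) hR (by
    refine ⟨(smul_mem_halfSpace hR _).2 hp, ?_⟩
    simpa [norm_smul_unitSphere p hR.le, radialDensity] using hpV)
  refine ⟨min δ (R / 2), by positivity, min_le_right _ _, fun σ hσ => ?_⟩
  have hσ' : 1 - δ < inner ℝ (p : Space n) σ := by linarith [min_le_left δ (R / 2)]
  refine ⟨(smul_mem_halfSpace hR _).1 (h σ hσ' R (by simpa using hδ.le)).1, fun r hr => ?_⟩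
  have hr0 : 0 ≤ r := by
    have := (abs_le.1 (hr.trans (min_le_right _ _))).1
    linarith
  have := (h σ hσ' r (hr.trans (min_le_left _ _))).2
  simpa [norm_smul_unitSphere σ hr0, radialDensity] using this

lemma le_integral_of_le_radialDensity (hc : Continuous φ) {σ : UnitSphere n} {a b m : ℝ}
    (hab : a ≤ b) (h : ∀ r ∈ Icc a b, m ≤ radialDensity φ r σ) :
    m * (b - a) ≤ ∫ r in a..b, radialDensity φ r σ := by
  have := intervalIntegral.integral_mono_on (μ := volume) (f := fun _ => m) hab
    (continuous_const.intervalIntegrable a b)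
    ((continuous_radialDensity_left hc σ).intervalIntegrable a b) h
  simpa [mul_comm] using this

lemma integral_le_of_radialDensity_le (hc : Continuous φ) {σ : UnitSphere n} {a b C : ℝ}
    (hab : a ≤ b) (h : ∀ r ∈ Icc a b, radialDensity φ r σ ≤ C) :
    ∫ r in a..b, radialDensity φ r σ ≤ C * (b - a) := by
  have := intervalIntegral.integral_mono_on (μ := volume) (g := fun _ => C) hab
    ((continuous_radialDensity_left hc σ).intervalIntegrable a b)
    (continuous_const.intervalIntegrable a b) h
  simpa [mul_comm] using this

/-- The first variation argument. If the mean curvature at `R • p` were less than that at `R • q`,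
then pushing outwards near `p` and inwards near `q` with the volume fixed would decrease the
perimeter. -/
lemma HalfBallsMinimize.radialLogDeriv_le (hiso : HalfBallsMinimize φ) (hc : Continuous φ)
    (hd : ContDiffOn ℝ 1 φ (halfSpace n)) (hpos : ∀ x ∈ halfSpace n, 0 < φ x) (hR : 0 < R)
    {p q : UnitSphere n} (hp : p ∈ upperSphere n) (hq : q ∈ upperSphere n) :
    (n + radialLogDeriv φ (R • (q : Space n))) / R ≤
      (n + radialLogDeriv φ (R • (p : Space n))) / R := by
  by_contra hlt
  rw [not_le] at hlt
  obtain ⟨κ₁, hκp, hκ₁⟩ := exists_between hlt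
  obtain ⟨κ₂, hκ, hκq⟩ := exists_between hκ₁
  have hΦpos : ∀ σ ∈ upperSphere n, ∀ r : ℝ, 0 < r → 0 < radialDensity φ r σ := fun σ hσ r hr =>
    mul_pos (pow_pos hr _) (hpos _ ((smul_mem_halfSpace hr _).2 hσ))
  have hmp := hΦpos p hp R hR
  have hmq := hΦpos q hq R hR
  -- `mp` and `mq` are lower bounds for the density near the two points
  set mp := radialDensity φ R p / 2 with hmp_def
  set mq := radialDensity φ R q / 2 with hmq_def
  have hmp0 : 0 < mp := by positivity
  have hmq0 : 0 < mq := by positivity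
  obtain ⟨δ₁, hδ₁, hδ₁R, hcap₁⟩ := exists_cap_forall_mem hd hpos hR hp
    (V := Iio κ₁ ×ˢ Ioi mp) (isOpen_Iio.prod isOpen_Ioi) ⟨hκp, half_lt_self hmp⟩
  obtain ⟨δ₂, hδ₂, hδ₂R, hcap₂⟩ := exists_cap_forall_mem hd hpos hR hq
    (V := Ioi κ₂ ×ˢ Ioi mq) (isOpen_Ioi.prod isOpen_Ioi) ⟨hκq, half_lt_self hmq⟩
  set g₁ := capBump p δ₁ with hg₁
  set g₂ := capBump q δ₂ with hg₂
  have hg₁0 : ∀ σ : UnitSphere n, 0 ≤ g₁ σ := fun σ => capBump_nonneg p _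
  have hg₂0 : ∀ σ : UnitSphere n, 0 ≤ g₂ σ := fun σ => capBump_nonneg q _
  have hg₁1 : ∀ σ : UnitSphere n, g₁ σ ≤ 1 := fun σ => capBump_le_one p _
  have hg₂1 : ∀ σ : UnitSphere n, g₂ σ ≤ 1 := fun σ => capBump_le_one q _
  have hg₁c : Continuous fun σ : UnitSphere n => g₁ σ := continuous_capBump p
  have hg₂c : Continuous fun σ : UnitSphere n => g₂ σ := continuous_capBump q
  have hsupp₁ : ∀ σ : UnitSphere n, g₁ σ ≠ 0 → 1 - δ₁ < inner ℝ (p : Space n) σ :=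
    fun σ h => lt_inner_of_capBump_ne_zero p hδ₁ h
  have hsupp₂ : ∀ σ : UnitSphere n, g₂ σ ≠ 0 → 1 - δ₂ < inner ℝ (q : Space n) σ :=
    fun σ h => lt_inner_of_capBump_ne_zero q hδ₂ h
  -- on the first cap the mean curvature is below `κ₁`, on the second one above `κ₂`
  have hdisj : ∀ σ : UnitSphere n, g₁ σ = 0 ∨ g₂ σ = 0 := by
    intro σ
    by_contra h
    rw [not_or] at h
    have h1 := ((hcap₁ σ (hsupp₁ σ h.1)).2 R (by simpa using hδ₁.le)).1
    have h2 := ((hcap₂ σ (hsupp₂ σ h.2)).2 R (by simpa using hδ₂.le)).1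
    exact absurd (lt_trans h2 h1) (not_lt.2 hκ.le)
  obtain ⟨C₁, hC₁0, hC₁⟩ := exists_norm_fderiv_le (g := g₁) (fun x hx => contDiffAt_capBump p hx)
    (fun r hr x => capBump_smul p hr x) (show 0 < R / 4 by positivity)
  obtain ⟨C₂, hC₂0, hC₂⟩ := exists_norm_fderiv_le (g := g₂) (fun x hx => contDiffAt_capBump q hx)
    (fun r hr x => capBump_smul q hr x) (show 0 < R / 4 by positivity)
  obtain ⟨B, hB0, hB⟩ := exists_radialDensity_bound (n := n) hc R
  -- volume gained over the first cap and lost over the second one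
  set gain : ℝ → ℝ := fun t =>
    ∫ σ : UnitSphere n, (∫ r in R..(R + t * g₁ σ), radialDensity φ r σ) ∂(hemi n) with hgain
  set loss : ℝ → ℝ := fun τ =>
    ∫ σ : UnitSphere n, (∫ r in (R - τ * g₂ σ)..R, radialDensity φ r σ) ∂(hemi n) with hloss
  have hΦc : Continuous fun x : UnitSphere n × ℝ => radialDensity φ x.2 x.1 :=
    (continuous_radialDensity hc).comp continuous_swap
  have hgc : ∀ t : ℝ, Continuous fun σ : UnitSphere n =>
      ∫ r in R..(R + t * g₁ σ), radialDensity φ r σ := fun t =>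
    intervalIntegral.continuous_parametric_intervalIntegral_of_continuous
      (f := fun (σ : UnitSphere n) r => radialDensity φ r σ) hΦc
      (continuous_const.add (continuous_const.mul hg₁c))
  have hlc2 : Continuous fun x : ℝ × UnitSphere n =>
      ∫ r in (R - x.1 * g₂ x.2)..R, radialDensity φ r x.2 := by
    simp only [intervalIntegral.integral_symm R]
    refine Continuous.neg ?_
    exact intervalIntegral.continuous_parametric_intervalIntegral_of_continuous
      (f := fun (x : ℝ × UnitSphere n) r => radialDensity φ r x.2)
      ((continuous_radialDensity hc).comp (by fun_prop :
        Continuous fun y : (ℝ × UnitSphere n) × ℝ => (y.2, y.1.2)))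
      (continuous_const.sub (continuous_fst.mul (hg₂c.comp continuous_snd)))
  have hlc : ∀ τ : ℝ, Continuous fun σ : UnitSphere n =>
      ∫ r in (R - τ * g₂ σ)..R, radialDensity φ r σ := fun τ =>
    hlc2.comp (by fun_prop : Continuous fun σ : UnitSphere n => (τ, σ))
  have hloss_c : Continuous loss := by
    have := continuous_parametric_integral_of_continuous (μ := hemi n)
      (f := fun (τ : ℝ) (σ : UnitSphere n) => ∫ r in (R - τ * g₂ σ)..R, radialDensity φ r σ)
      hlc2 isCompact_univ
    simpa only [Measure.restrict_univ] using this
  set b₁ := mp * ∫ σ : UnitSphere n, g₁ σ ∂(hemi n) with hb₁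
  set b₂ := mq * ∫ σ : UnitSphere n, g₂ σ ∂(hemi n) with hb₂
  have hb₁0 : 0 < b₁ := mul_pos hmp0 (integral_capBump_pos p hδ₁ fun σ hσ => (hcap₁ σ hσ).1)
  have hb₂0 : 0 < b₂ := mul_pos hmq0 (integral_capBump_pos q hδ₂ fun σ hσ => (hcap₂ σ hσ).1)
  have hgain_ge : ∀ t, 0 ≤ t → t ≤ δ₁ → b₁ * t ≤ gain t := by
    intro t ht0 ht
    have : b₁ * t = ∫ σ : UnitSphere n, mp * (t * g₁ σ) ∂(hemi n) := by
      rw [integral_const_mul, integral_const_mul, hb₁]; ring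
    rw [this]
    refine integral_mono
      (integrable_continuous_hemi (continuous_const.mul (continuous_const.mul hg₁c)))
      (integrable_continuous_hemi (hgc t)) fun σ => ?_
    by_cases h : g₁ σ = 0
    · simp [h]
    · have hs : t * g₁ σ ≤ δ₁ := (mul_le_of_le_one_right ht0 (hg₁1 σ)).trans ht
      have hs0 : 0 ≤ t * g₁ σ := mul_nonneg ht0 (hg₁0 σ)
      have := le_integral_of_le_radialDensity hc (σ := σ) (a := R) (b := R + t * g₁ σ) (m := mp)
        (by linarith) fun r hr => (((hcap₁ σ (hsupp₁ σ h)).2 r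
          (abs_le.2 ⟨by linarith [hr.1], by linarith [hr.2]⟩)).2 : mp < _).le
      simpa using this
  have hloss_ge : ∀ t, 0 ≤ t → t ≤ δ₂ → b₂ * t ≤ loss t := by
    intro t ht0 ht
    have : b₂ * t = ∫ σ : UnitSphere n, mq * (t * g₂ σ) ∂(hemi n) := by
      rw [integral_const_mul, integral_const_mul, hb₂]; ring
    rw [this]
    refine integral_mono
      (integrable_continuous_hemi (continuous_const.mul (continuous_const.mul hg₂c)))
      (integrable_continuous_hemi (hlc t)) fun σ => ?_
    by_cases h : g₂ σ = 0
    · simp [h]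
    · have hs : t * g₂ σ ≤ δ₂ := (mul_le_of_le_one_right ht0 (hg₂1 σ)).trans ht
      have hs0 : 0 ≤ t * g₂ σ := mul_nonneg ht0 (hg₂0 σ)
      have := le_integral_of_le_radialDensity hc (σ := σ) (a := R - t * g₂ σ) (b := R) (m := mq)
        (by linarith) fun r hr => (((hcap₂ σ (hsupp₂ σ h)).2 r
          (abs_le.2 ⟨by linarith [hr.1], by linarith [hr.2]⟩)).2 : mq < _).le
      simpa using this
  set μ := (hemi n).real univ with hμ
  have hgain_le : ∀ t, 0 ≤ t → t ≤ δ₁ → gain t ≤ B * μ * t := by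
    intro t ht0 ht
    have : B * μ * t = ∫ _ : UnitSphere n, B * t ∂(hemi n) := by
      rw [integral_const, smul_eq_mul]; ring
    rw [this]
    refine integral_mono (integrable_continuous_hemi (hgc t)) (integrable_const _) fun σ => ?_
    have hs : t * g₁ σ ≤ t := mul_le_of_le_one_right ht0 (hg₁1 σ)
    have hs0 : 0 ≤ t * g₁ σ := mul_nonneg ht0 (hg₁0 σ)
    refine (integral_le_of_radialDensity_le hc (C := B) (by linarith) fun r hr =>
      hB r ⟨hR.le.trans hr.1, by linarith [hr.2]⟩ σ).trans ?_
    rw [add_sub_cancel_left]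
    exact mul_le_mul_of_nonneg_left hs hB0
  -- for small `t`, some `τ ∈ [0, K * t]` makes the loss equal to `gain t`
  set K := B * μ / b₂ with hK
  have hK0 : 0 ≤ K := div_nonneg (mul_nonneg hB0 measureReal_nonneg) hb₂0.le
  set A := ∫ σ, radialDensity φ R σ ∂(hemi n) with hA
  have hA0 : 0 ≤ A := by
    refine integral_nonneg_of_ae ?_
    filter_upwards [ae_restrict_mem (isOpen_upperSphere n).measurableSet] with σ hσ
    exact (hΦpos σ hσ R hR).le
  set C := max C₁ C₂ with hC
  -- the comparison for small perturbations
  have key : ∀ t, 0 < t → t ≤ δ₁ → K * t ≤ δ₂ →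
      (κ₂ - κ₁) * b₁ ≤ (C * (1 + K)) ^ 2 * A * t := by
    intro t ht0 ht hKt
    have hKt0 : 0 ≤ K * t := mul_nonneg hK0 ht0.le
    have hgt : b₁ * t ≤ gain t := hgain_ge t ht0.le ht
    obtain ⟨τ, hτ, hτeq⟩ : ∃ τ ∈ Icc 0 (K * t), loss τ = gain t := by
      refine intermediate_value_Icc hKt0 hloss_c.continuousOn ⟨?_, ?_⟩
      · have : loss 0 = 0 := by simp [hloss]
        rw [this]
        exact (mul_nonneg hb₁0.le ht0.le).trans hgt
      · refine (hgain_le t ht0.le ht).trans (le_trans (le_of_eq ?_) (hloss_ge _ hKt0 hKt))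
        rw [hK]; field_simp
    have hτ2 : τ ≤ δ₂ := hτ.2.trans hKt
    have hG := isRadialPerturbation_sub (R := R) (C := C) (t := t) (τ := τ) (g₁ := g₁) (g₂ := g₂)
      (fun x hx => contDiffAt_capBump p hx) (fun x hx => contDiffAt_capBump q hx)
      (fun r hr x => capBump_smul p hr x) (fun r hr x => capBump_smul q hr x)
      (fun x => ⟨capBump_nonneg p x, capBump_le_one p x⟩)
      (fun x => ⟨capBump_nonneg q x, capBump_le_one q x⟩)
      (fun x hx => (hC₁ x hx).trans (le_max_left _ _))
      (fun x hx => (hC₂ x hx).trans (le_max_right _ _)) hR ht0.le hτ.1 (ht.trans hδ₁R)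
      (hτ2.trans hδ₂R)
    have hii : ∀ (σ : UnitSphere n) (a b : ℝ),
        IntervalIntegrable (fun r => radialDensity φ r σ) volume a b := fun σ a b =>
      (continuous_radialDensity_left hc σ).intervalIntegrable a b
    have hRc : Continuous fun σ : UnitSphere n => ∫ r in (0 : ℝ)..R, radialDensity φ r σ :=
      intervalIntegral.continuous_parametric_intervalIntegral_of_continuous
        (f := fun (σ : UnitSphere n) r => radialDensity φ r σ) hΦc continuous_const
    have hvol : ∫ σ : UnitSphere n,
        (∫ r in (0 : ℝ)..(R + (t * g₁ σ - τ * g₂ σ)), radialDensity φ r σ) ∂(hemi n) =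
        ∫ σ : UnitSphere n, (∫ r in (0 : ℝ)..R, radialDensity φ r σ) ∂(hemi n) := by
      have e : ∀ σ : UnitSphere n,
          ∫ r in (0 : ℝ)..(R + (t * g₁ σ - τ * g₂ σ)), radialDensity φ r σ =
          (∫ r in (0 : ℝ)..R, radialDensity φ r σ) +
          ((∫ r in R..(R + t * g₁ σ), radialDensity φ r σ) -
            ∫ r in (R - τ * g₂ σ)..R, radialDensity φ r σ) := by
        intro σ
        rcases hdisj σ with h | h
        · rw [h, mul_zero, zero_sub, add_zero, intervalIntegral.integral_same, zero_sub,
            ← sub_eq_add_neg, ← sub_eq_add_neg, eq_sub_iff_add_eq,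
            intervalIntegral.integral_add_adjacent_intervals (hii _ _ _) (hii _ _ _)]
        · rw [h, mul_zero, sub_zero, sub_zero, intervalIntegral.integral_same, sub_zero,
            intervalIntegral.integral_add_adjacent_intervals (hii _ _ _) (hii _ _ _)]
      simp only [e]
      have i1 := integrable_continuous_hemi (hgc t)
      have i2 := integrable_continuous_hemi (hlc τ)
      have i12 : Integrable (fun σ : UnitSphere n =>
          (∫ r in R..(R + t * g₁ σ), radialDensity φ r σ) -
            ∫ r in (R - τ * g₂ σ)..R, radialDensity φ r σ) (hemi n) := i1.sub i2
      rw [integral_add (integrable_continuous_hemi hRc) i12, integral_sub i1 i2]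
      have : loss τ = gain t := hτeq
      simp only [hloss, hgain] at this
      rw [this, sub_self, add_zero]
    have hcomp := hiso.integral_le hc hd hpos hR hG hvol
    have hpt : ∀ σ : UnitSphere n, radialDensity φ (R + (t * g₁ σ - τ * g₂ σ)) σ ≤
        radialDensity φ R σ + (κ₁ * (∫ r in R..(R + t * g₁ σ), radialDensity φ r σ) -
          κ₂ * ∫ r in (R - τ * g₂ σ)..R, radialDensity φ r σ) := by
      intro σ
      by_cases h1 : g₁ σ = 0
      · by_cases h2 : g₂ σ = 0
        · simp [h1, h2]
        · have hs : τ * g₂ σ ≤ δ₂ := (mul_le_of_le_one_right hτ.1 (hg₂1 σ)).trans hτ2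
          have hs0 : 0 ≤ τ * g₂ σ := mul_nonneg hτ.1 (hg₂0 σ)
          have hcap := hcap₂ σ (hsupp₂ σ h2)
          have := mul_integral_radialDensity_le_sub hc hd hpos hcap.1 (a := R - τ * g₂ σ) (b := R)
            (κ := κ₂) (by linarith) (by linarith) fun r hr => ((hcap.2 r
              (abs_le.2 ⟨by linarith [hr.1], by linarith [hr.2]⟩)).1 : κ₂ < _).le
          rw [h1, mul_zero, zero_sub, add_zero, intervalIntegral.integral_same,
            ← sub_eq_add_neg]
          linarith
      · have h2 : g₂ σ = 0 := (hdisj σ).resolve_left h1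
        have hs : t * g₁ σ ≤ δ₁ := (mul_le_of_le_one_right ht0.le (hg₁1 σ)).trans ht
        have hs0 : 0 ≤ t * g₁ σ := mul_nonneg ht0.le (hg₁0 σ)
        have hcap := hcap₁ σ (hsupp₁ σ h1)
        have := sub_le_mul_integral_radialDensity hc hd hpos hcap.1 (a := R) (b := R + t * g₁ σ)
          (κ := κ₁) hR (by linarith) fun r hr => ((hcap.2 r
            (abs_le.2 ⟨by linarith [hr.1], by linarith [hr.2]⟩)).1 : _ < κ₁).le
        rw [h2, mul_zero, sub_zero, sub_zero, intervalIntegral.integral_same]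
        linarith
    have i1 := (integrable_continuous_hemi (hgc t)).const_mul κ₁
    have i2 := (integrable_continuous_hemi (hlc τ)).const_mul κ₂
    have i0 := integrable_continuous_hemi (continuous_radialDensity_right hc R)
    have i12 : Integrable (fun σ : UnitSphere n =>
        κ₁ * (∫ r in R..(R + t * g₁ σ), radialDensity φ r σ) -
          κ₂ * ∫ r in (R - τ * g₂ σ)..R, radialDensity φ r σ) (hemi n) := i1.sub i2
    have hint := integral_mono (integrable_continuous_hemi (hG.continuous_radialDensity hc))
      (i0.add i12) hpt
    simp only [Pi.add_apply] at hint
    rw [integral_add i0 i12, integral_sub i1 i2, integral_const_mul,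
      integral_const_mul] at hint
    change _ ≤ A + (κ₁ * gain t - κ₂ * loss τ) at hint
    rw [hτeq] at hint
    set L := C * (t + τ) with hL
    have hC0 : 0 ≤ C := hC₁0.trans (le_max_left _ _)
    have hLle : L ≤ C * (1 + K) * t := by
      rw [hL, mul_assoc]
      refine mul_le_mul_of_nonneg_left ?_ hC0
      linarith [hτ.2]
    have hL0 : 0 ≤ L := mul_nonneg hC0 (by linarith [hτ.1])
    have hLsq : L ^ 2 ≤ (C * (1 + K) * t) ^ 2 := pow_le_pow_left₀ hL0 hLle 2
    have h3 : A ≤ (1 + L ^ 2) * (A + (κ₁ * gain t - κ₂ * gain t)) :=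
      hcomp.trans (mul_le_mul_of_nonneg_left hint (by positivity))
    have h4 : (κ₂ - κ₁) * (b₁ * t) ≤ (κ₂ - κ₁) * gain t :=
      mul_le_mul_of_nonneg_left hgt (by linarith)
    have h6 : 0 ≤ (κ₂ - κ₁) * gain t := le_trans (by
      have : 0 ≤ κ₂ - κ₁ := by linarith
      positivity) h4
    have h5 : (κ₂ - κ₁) * (b₁ * t) ≤ (C * (1 + K) * t) ^ 2 * A := by
      have h7 : (κ₂ - κ₁) * gain t ≤ L ^ 2 * A := by
        nlinarith [mul_nonneg (sq_nonneg L) h6]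
      exact h4.trans (h7.trans (mul_le_mul_of_nonneg_right hLsq hA0))
    refine le_of_mul_le_mul_right ?_ ht0
    calc (κ₂ - κ₁) * b₁ * t = (κ₂ - κ₁) * (b₁ * t) := by ring
      _ ≤ _ := h5
      _ = _ := by ring
  -- letting the size of the perturbation tend to zero
  have hlim : Tendsto (fun t : ℝ => (C * (1 + K)) ^ 2 * A * t) (𝓝[>] 0) (𝓝 0) :=
    tendsto_nhdsWithin_of_tendsto_nhds (Continuous.tendsto' (by fun_prop) _ _ (by simp))
  have hKlim : Tendsto (fun t : ℝ => K * t) (𝓝[>] 0) (𝓝 0) :=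
    tendsto_nhdsWithin_of_tendsto_nhds (Continuous.tendsto' (by fun_prop) _ _ (by simp))
  have hfin : (κ₂ - κ₁) * b₁ ≤ 0 := by
    refine ge_of_tendsto hlim ?_
    filter_upwards [self_mem_nhdsWithin, hKlim.eventually (eventually_le_nhds hδ₂),
      nhdsWithin_le_nhds (eventually_le_nhds hδ₁)] with t ht0 hKt ht
    exact key t ht0 ht hKt
  exact absurd hfin (not_le.2 (mul_pos (by linarith) hb₁0))

lemma HalfBallsMinimize.radialLogDeriv_eq (hiso : HalfBallsMinimize φ) (hc : Continuous φ)
    (hd : ContDiffOn ℝ 1 φ (halfSpace n)) (hpos : ∀ x ∈ halfSpace n, 0 < φ x)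
    {x y : Space n} (hx : x ∈ halfSpace n) (hy : y ∈ halfSpace n) (hxy : ‖x‖ = ‖y‖) :
    radialLogDeriv φ x = radialLogDeriv φ y := by
  have hR : 0 < ‖x‖ := norm_pos_iff.2 (ne_zero_of_mem_halfSpace hx)
  have hunit : ∀ z ∈ halfSpace n, ‖z‖ = ‖x‖ →
      ∃ σ ∈ upperSphere n, ‖x‖ • (σ : Space n) = z := by
    intro z hz hzx
    refine ⟨⟨‖x‖⁻¹ • z, by simp [norm_smul, hzx, hR.ne']⟩,
      (smul_mem_halfSpace (inv_pos.2 hR) _).2 hz, ?_⟩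
    simp [smul_smul, hR.ne']
  obtain ⟨p, hp, hpx⟩ := hunit x hx rfl
  obtain ⟨q, hq, hqy⟩ := hunit y hy hxy.symm
  have h1 := hiso.radialLogDeriv_le hc hd hpos hR hp hq
  have h2 := hiso.radialLogDeriv_le hc hd hpos hR hq hp
  rw [hpx, hqy] at h1 h2
  have := le_antisymm h1 h2
  rw [div_left_inj' hR.ne'] at this
  linarith

end

/-! ### Negative exponents are not isoperimetric -/

section

section Profile

/-- The radial factor of a density `x_N ^ k * exp (-b * ‖x‖ ^ 2)` in polar coordinates, where `m =
n + k`. -/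
def gaussProfile (m b r : ℝ) : ℝ := r ^ m * Real.exp (-b * r ^ 2)

variable {m b : ℝ}

lemma continuous_gaussProfile (hm : 0 ≤ m) : Continuous (gaussProfile m b) := by
  have h : Continuous fun r : ℝ => r ^ m := Real.continuous_rpow_const hm
  unfold gaussProfile
  fun_prop

lemma gaussProfile_pos {r : ℝ} (hr : 0 < r) : 0 < gaussProfile m b r := by
  unfold gaussProfile
  positivity

lemma integrableOn_gaussProfile (hm : 0 ≤ m) (hb : 0 < b) :
    IntegrableOn (gaussProfile m b) (Ioi 0) :=
  integrableOn_rpow_mul_exp_neg_mul_sq hb (by linarith)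

/-- On `[0, 1]` the profile is increasing up to a constant factor. -/
lemma gaussProfile_le (hm : 0 ≤ m) (hb : 0 < b) {s r : ℝ} (hs : 0 ≤ s) (hsr : s ≤ r)
    (hr : r ≤ 1) : gaussProfile m b s ≤ Real.exp b * gaussProfile m b r := by
  have h1 : s ^ m ≤ r ^ m := Real.rpow_le_rpow hs hsr hm
  have h2 : Real.exp (-b * s ^ 2) ≤ Real.exp b * Real.exp (-b * r ^ 2) := by
    rw [← Real.exp_add, Real.exp_le_exp]
    have : r ^ 2 ≤ 1 := pow_le_one₀ (hs.trans hsr) hr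
    nlinarith [sq_nonneg s]
  calc s ^ m * Real.exp (-b * s ^ 2) ≤ r ^ m * (Real.exp b * Real.exp (-b * r ^ 2)) :=
        mul_le_mul h1 h2 (Real.exp_pos _).le (Real.rpow_nonneg (hs.trans hsr) _)
    _ = Real.exp b * gaussProfile m b r := by rw [gaussProfile]; ring

/-- A lower bound for the Gaussian tail, from the interval `[ρ, ρ + 1 / ρ]` alone. -/
lemma gaussProfile_div_le_integral_Ioi (hm : 0 ≤ m) (hb : 0 < b) {ρ : ℝ} (hρ : 1 ≤ ρ) :
    Real.exp (-(3 * b)) * gaussProfile m b ρ / ρ ≤ ∫ r in Ioi ρ, gaussProfile m b r := by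
  have hρ0 : 0 < ρ := by linarith
  have hint : IntegrableOn (gaussProfile m b) (Ioi ρ) :=
    (integrableOn_gaussProfile hm hb).mono_set (Ioi_subset_Ioi hρ0.le)
  have hsub : Ioc ρ (ρ + 1 / ρ) ⊆ Ioi ρ := Ioc_subset_Ioi_self
  refine le_trans ?_ (setIntegral_mono_set hint ?_ hsub.eventuallyLE)
  · have hle : ρ ≤ ρ + 1 / ρ := by
      have : 0 < 1 / ρ := by positivity
      linarith
    rw [← intervalIntegral.integral_of_le hle]
    have h := intervalIntegral.integral_mono_on (μ := volume) (a := ρ) (b := ρ + 1 / ρ)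
      (f := fun _ => Real.exp (-(3 * b)) * gaussProfile m b ρ) (g := gaussProfile m b) hle
      (continuous_const.intervalIntegrable _ _)
      ((continuous_gaussProfile hm).intervalIntegrable _ _) fun r hr => ?_
    · rw [intervalIntegral.integral_const, add_sub_cancel_left, smul_eq_mul] at h
      refine le_trans (le_of_eq ?_) h
      ring
    · have h1 : ρ ^ m ≤ r ^ m := Real.rpow_le_rpow hρ0.le hr.1 hm
      have h2 : Real.exp (-(3 * b)) * Real.exp (-b * ρ ^ 2) ≤ Real.exp (-b * r ^ 2) := by
        rw [← Real.exp_add, Real.exp_le_exp]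
        have h3 : r ^ 2 ≤ (ρ + 1 / ρ) ^ 2 := pow_le_pow_left₀ (hρ0.le.trans hr.1) hr.2 2
        have h4 : (ρ + 1 / ρ) ^ 2 = ρ ^ 2 + 2 + (1 / ρ) ^ 2 := by field_simp; ring
        have h5 : (1 / ρ) ^ 2 ≤ 1 := pow_le_one₀ (by positivity) ((div_le_one hρ0).2 hρ)
        nlinarith
      calc Real.exp (-(3 * b)) * gaussProfile m b ρ
          = ρ ^ m * (Real.exp (-(3 * b)) * Real.exp (-b * ρ ^ 2)) := by rw [gaussProfile]; ring
        _ ≤ gaussProfile m b r := mul_le_mul h1 h2 (by positivity)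
            (Real.rpow_nonneg (hρ0.le.trans hr.1) _)
  · filter_upwards [ae_restrict_mem measurableSet_Ioi] with r hr
    exact (gaussProfile_pos (hρ0.trans hr)).le

/-- A small ball and the complement of a large one with the same volume, the latter having the
smaller boundary. -/
lemma exists_integral_gaussProfile_eq_and_lt (hm : 0 ≤ m) (hb : 0 < b) :
    ∃ r ρ : ℝ, 0 < r ∧ 0 < ρ ∧
      ∫ s in (0 : ℝ)..r, gaussProfile m b s = ∫ s in Ioi ρ, gaussProfile m b s ∧
      gaussProfile m b ρ < gaussProfile m b r := by
  have hfc := continuous_gaussProfile (b := b) hm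
  have hfi := integrableOn_gaussProfile hm hb
  have hWc : Continuous fun r => ∫ s in (0 : ℝ)..r, gaussProfile m b s :=
    intervalIntegral.continuous_primitive (fun a b => hfc.intervalIntegrable a b) 0
  have hW1 : 0 < ∫ s in (0 : ℝ)..1, gaussProfile m b s :=
    intervalIntegral.intervalIntegral_pos_of_pos_on (hfc.intervalIntegrable _ _)
      (fun x hx => gaussProfile_pos hx.1) one_pos
  have htail : ∀ ρ, 0 ≤ ρ → ∫ s in Ioi ρ, gaussProfile m b s =
      (∫ s in Ioi 0, gaussProfile m b s) - ∫ s in (0 : ℝ)..ρ, gaussProfile m b s := by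
    intro ρ hρ
    rw [eq_sub_iff_add_eq', intervalIntegral.integral_of_le hρ,
      ← setIntegral_union (Ioc_disjoint_Ioi le_rfl) measurableSet_Ioi
      (hfi.mono_set Ioc_subset_Ioi_self) (hfi.mono_set (Ioi_subset_Ioi hρ)),
      Ioc_union_Ioi_eq_Ioi hρ]
  have htail0 : Tendsto (fun ρ => ∫ s in Ioi ρ, gaussProfile m b s) atTop (𝓝 0) := by
    have h1 := (intervalIntegral_tendsto_integral_Ioi 0 hfi tendsto_id).const_sub
      (∫ s in Ioi 0, gaussProfile m b s)
    rw [sub_self] at h1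
    refine h1.congr' ?_
    filter_upwards [eventually_ge_atTop 0] with ρ hρ
    rw [htail ρ hρ]; rfl
  have hdecay : Tendsto (fun ρ : ℝ => (ρ ^ 2) ^ m * Real.exp (-b * ρ ^ 2)) atTop (𝓝 0) :=
    (tendsto_rpow_mul_exp_neg_mul_atTop_nhds_zero m b hb).comp (tendsto_pow_atTop two_ne_zero)
  -- the constant in the lower bound `c₀ / ρ` for the radius of the small ball
  set c₀ : ℝ := Real.exp (-(4 * b)) with hc₀
  have hc₀0 : 0 < c₀ := Real.exp_pos _
  have hc₀1 : c₀ ≤ 1 := Real.exp_le_one_iff.2 (by linarith)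
  have hthr : 0 < Real.exp (-(2 * b)) * c₀ ^ m := by positivity
  obtain ⟨ρ, hρ1, hρε, hρd⟩ := ((eventually_ge_atTop (1 : ℝ)).and
    ((htail0.eventually_lt_const hW1).and (hdecay.eventually_lt_const hthr))).exists
  have hρ0 : 0 < ρ := by linarith
  have hlow := gaussProfile_div_le_integral_Ioi hm hb hρ1
  have hfρ : 0 < gaussProfile m b ρ := gaussProfile_pos hρ0
  obtain ⟨r, hr, hreq⟩ := intermediate_value_Icc (zero_le_one (α := ℝ)) hWc.continuousOn
    (show (∫ s in Ioi ρ, gaussProfile m b s) ∈ _ from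
      ⟨by rw [intervalIntegral.integral_same]; exact le_trans (by positivity) hlow, hρε.le⟩)
  simp only at hreq
  have hr0 : 0 < r := by
    refine lt_of_le_of_ne hr.1 fun h => ?_
    rw [← h, intervalIntegral.integral_same] at hreq
    rw [← hreq] at hlow
    exact absurd hlow (not_le.2 (by positivity))
  refine ⟨r, ρ, hr0, hρ0, hreq, ?_⟩
  by_contra hle
  rw [not_lt] at hle
  have hfr : 0 < gaussProfile m b r := gaussProfile_pos hr0
  have hup : ∫ s in (0 : ℝ)..r, gaussProfile m b s ≤ Real.exp b * gaussProfile m b r * r := by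
    have h := intervalIntegral.integral_mono_on (μ := volume) (a := 0) (b := r)
      (f := gaussProfile m b) (g := fun _ => Real.exp b * gaussProfile m b r) hr.1
      (hfc.intervalIntegrable _ _) (continuous_const.intervalIntegrable _ _)
      fun s hs => gaussProfile_le hm hb hs.1 hs.2 hr.2
    rw [intervalIntegral.integral_const, sub_zero, smul_eq_mul] at h
    linarith
  have hrρ : c₀ / ρ ≤ r := by
    have h1 : Real.exp (-(3 * b)) * gaussProfile m b r / ρ ≤
        Real.exp b * gaussProfile m b r * r := by
      refine le_trans ?_ (hlow.trans (hreq ▸ hup))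
      gcongr
    have h2 : Real.exp (-(3 * b)) = Real.exp b * c₀ := by
      rw [hc₀, ← Real.exp_add]; ring_nf
    rw [h2] at h1
    have h3 : Real.exp b * gaussProfile m b r * (c₀ / ρ) ≤ Real.exp b * gaussProfile m b r * r :=
      le_trans (le_of_eq (by ring)) h1
    exact le_of_mul_le_mul_left h3 (by positivity)
  have h4 := (gaussProfile_le hm hb (by positivity) hrρ hr.2).trans
    (mul_le_mul_of_nonneg_left hle (Real.exp_pos b).le)
  have h5 : Real.exp (-b) * (c₀ ^ m / ρ ^ m) ≤ gaussProfile m b (c₀ / ρ) := by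
    rw [gaussProfile, Real.div_rpow hc₀0.le hρ0.le, mul_comm]
    refine mul_le_mul_of_nonneg_left ?_ (by positivity)
    rw [Real.exp_le_exp]
    have : (c₀ / ρ) ^ 2 ≤ 1 :=
      pow_le_one₀ (by positivity) ((div_le_one hρ0).2 (hc₀1.trans hρ1))
    nlinarith
  have h6 : Real.exp (-b) * (c₀ ^ m / ρ ^ m) ≤
      Real.exp b * (ρ ^ m * Real.exp (-b * ρ ^ 2)) := h5.trans h4
  have h7 : (ρ ^ 2) ^ m = ρ ^ m * ρ ^ m := by
    rw [pow_two, Real.mul_rpow hρ0.le hρ0.le]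
  have h8 : Real.exp (-(2 * b)) = Real.exp (-b) * Real.exp (-b) := by
    rw [← Real.exp_add]; ring_nf
  have hρm : 0 < ρ ^ m := by positivity
  rw [h7, h8] at hρd
  have h9 : Real.exp (-b) * Real.exp b = 1 := by rw [← Real.exp_add]; simp
  have h10 : Real.exp (-b) * Real.exp (-b) * c₀ ^ m ≤
      ρ ^ m * ρ ^ m * Real.exp (-b * ρ ^ 2) := by
    calc Real.exp (-b) * Real.exp (-b) * c₀ ^ m
        = Real.exp (-b) * ρ ^ m * (Real.exp (-b) * (c₀ ^ m / ρ ^ m)) := by field_simp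
      _ ≤ Real.exp (-b) * ρ ^ m * (Real.exp b * (ρ ^ m * Real.exp (-b * ρ ^ 2))) := by gcongr
      _ = (Real.exp (-b) * Real.exp b) * (ρ ^ m * ρ ^ m * Real.exp (-b * ρ ^ 2)) := by ring
      _ = _ := by rw [h9, one_mul]
  linarith

end Profile

variable {n : ℕ} {φ : Space n → ℝ}

lemma upperSphere_nonempty (n : ℕ) : (upperSphere n).Nonempty :=
  ⟨⟨EuclideanSpace.single (Fin.last n) 1, by simp⟩, by simp [upperSphere]⟩

lemma integral_hemi_pos {f : UnitSphere n → ℝ} (hf : Continuous f)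
    (hpos : ∀ σ ∈ upperSphere n, 0 < f σ) : 0 < ∫ σ, f σ ∂(hemi n) := by
  have hae : 0 ≤ᵐ[hemi n] f := by
    filter_upwards [ae_restrict_mem (isOpen_upperSphere n).measurableSet] with σ hσ
    exact (hpos σ hσ).le
  rw [integral_pos_iff_support_of_nonneg_ae hae (integrable_continuous_hemi hf)]
  refine lt_of_lt_of_le ?_ (measure_mono (show upperSphere n ⊆ Function.support f from
    fun σ hσ => (hpos σ hσ).ne'))
  rw [hemi, Measure.restrict_apply_self]
  exact (isOpen_upperSphere n).measure_pos _ (upperSphere_nonempty n)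

lemma HalfBallsMinimize.exponent_nonneg (hiso : HalfBallsMinimize φ) (hc : Continuous φ)
    (hd : ContDiffOn ℝ 1 φ (halfSpace n)) (hpos : ∀ x ∈ halfSpace n, 0 < φ x)
    {a k c : ℝ} (hk : 0 ≤ k)
    (hφ : ∀ x ∈ halfSpace n, φ x = a * x (Fin.last n) ^ k * Real.exp (c * ‖x‖ ^ 2)) :
    0 ≤ c := by
  by_contra hneg
  rw [not_le] at hneg
  set b : ℝ := -c with hb_def
  have hb : 0 < b := by linarith
  set m : ℝ := n + k with hm_def
  have hm : 0 ≤ m := by positivity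
  set J : UnitSphere n → ℝ := fun σ => Real.exp b * φ σ with hJ
  have hJc : Continuous J := by simp only [hJ]; fun_prop
  have hJpos : ∀ σ ∈ upperSphere n, 0 < J σ := fun σ hσ =>
    mul_pos (Real.exp_pos _) (hpos _ hσ)
  have hJ0 : 0 < ∫ σ, J σ ∂(hemi n) := integral_hemi_pos hJc hJpos
  have hΦ : ∀ σ ∈ upperSphere n, ∀ r : ℝ, 0 < r →
      radialDensity φ r σ = gaussProfile m b r * J σ := by
    intro σ hσ r hr
    have h1 := hφ _ ((smul_mem_halfSpace hr _).2 hσ)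
    have h2 := hφ _ (show (σ : Space n) ∈ halfSpace n from hσ)
    have hσ0 : 0 < (σ : Space n) (Fin.last n) := hσ
    rw [norm_smul_unitSphere σ hr.le, PiLp.smul_apply, smul_eq_mul,
      Real.mul_rpow hr.le hσ0.le] at h1
    rw [norm_unitSphere] at h2
    have h3 : Real.exp b * Real.exp (c * 1 ^ 2) = 1 := by
      rw [← Real.exp_add, hb_def]; simp
    simp only [radialDensity, gaussProfile, hJ]
    rw [h1, h2, hm_def, Real.rpow_add hr, Real.rpow_natCast, hb_def, neg_neg]
    rw [hb_def] at h3
    linear_combination (-(r ^ n * r ^ k * Real.exp (c * r ^ 2) * a *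
      (σ : Space n) (Fin.last n) ^ k)) * h3
  obtain ⟨r, ρ, hr, hρ, hvol, hlt⟩ := exists_integral_gaussProfile_eq_and_lt hm hb
  have hA : ∀ s, 0 < s → ∫ σ, radialDensity φ s σ ∂(hemi n) =
      gaussProfile m b s * ∫ σ, J σ ∂(hemi n) := by
    intro s hs
    rw [← integral_const_mul]
    refine integral_congr_ae ?_
    filter_upwards [ae_restrict_mem (isOpen_upperSphere n).measurableSet] with σ hσ
    exact hΦ σ hσ s hs
  have hball : weightedVolume φ (Metric.ball 0 r ∩ halfSpace n) =
      ENNReal.ofReal (∫ σ, J σ ∂(hemi n)) *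
        ENNReal.ofReal (∫ s in (0 : ℝ)..r, gaussProfile m b s) := by
    have h0 := (isRadialPerturbation_zero (n := n) hr).weightedVolume_starSet hr hc hpos
    simp only [Pi.zero_apply, add_zero, starSet_zero] at h0
    rw [h0, ← ENNReal.ofReal_mul hJ0.le, ← integral_mul_const]
    congr 1
    refine integral_congr_ae ?_
    filter_upwards [ae_restrict_mem (isOpen_upperSphere n).measurableSet] with σ hσ
    rw [← intervalIntegral.integral_const_mul, intervalIntegral.integral_of_le hr.le,
      intervalIntegral.integral_of_le hr.le]
    refine setIntegral_congr_fun measurableSet_Ioc fun s hs => ?_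
    rw [hΦ σ hσ s hs.1, mul_comm]
  have hGρ := isRadialPerturbation_zero (n := n) hρ
  have hmeas : MeasurableSet (halfSpace n \ starSet ρ (0 : Space n → ℝ)) :=
    (isOpen_halfSpace n).measurableSet.diff hGρ.isOpen_starSet.measurableSet
  have hcompl : weightedVolume φ (halfSpace n \ starSet ρ (0 : Space n → ℝ)) =
      ENNReal.ofReal (∫ σ, J σ ∂(hemi n)) *
        ENNReal.ofReal (∫ s in Ioi ρ, gaussProfile m b s) := by
    have h1 : weightedVolume φ (halfSpace n \ starSet ρ (0 : Space n → ℝ)) =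
        ∫⁻ x in halfSpace n, (halfSpace n \ starSet ρ (0 : Space n → ℝ)).indicator
          (fun x => ENNReal.ofReal (φ x)) x := by
      rw [weightedVolume, setLIntegral_indicator hmeas,
        inter_eq_self_of_subset_left sdiff_subset]
    have hint : IntegrableOn (gaussProfile m b) (Ioi ρ) :=
      (integrableOn_gaussProfile hm hb).mono_set (Ioi_subset_Ioi hρ.le)
    rw [h1, lintegral_halfSpace_polar _ ((by fun_prop : Measurable
      fun x => ENNReal.ofReal (φ x)).indicator hmeas),
      ofReal_integral_eq_lintegral_ofReal (integrable_continuous_hemi hJc),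
      ofReal_integral_eq_lintegral_ofReal hint, ← lintegral_mul_const' _ _
      (by rw [← ofReal_integral_eq_lintegral_ofReal hint]
          · exact ENNReal.ofReal_ne_top
          · filter_upwards [ae_restrict_mem measurableSet_Ioi] with s hs
            exact (gaussProfile_pos (hρ.trans hs)).le)]
    · refine lintegral_congr_ae ?_
      filter_upwards [ae_restrict_mem (isOpen_upperSphere n).measurableSet] with σ hσ
      rw [← lintegral_const_mul' _ _ ENNReal.ofReal_ne_top]
      have e1 : ∀ s ∈ Ioi (0 : ℝ), ENNReal.ofReal (s ^ n) *
          (halfSpace n \ starSet ρ (0 : Space n → ℝ)).indicator (fun x => ENNReal.ofReal (φ x))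
            (s • (σ : Space n)) =
          (Ici ρ).indicator
            (fun s => ENNReal.ofReal (J σ) * ENNReal.ofReal (gaussProfile m b s)) s := by
        intro s hs
        have hs0 : 0 < s := hs
        have hmem : s • (σ : Space n) ∈ halfSpace n \ starSet ρ (0 : Space n → ℝ) ↔
            s ∈ Ici ρ := by
          simp only [starSet, Set.mem_sdiff, mem_ofPred_eq, smul_mem_halfSpace hs0,
            norm_smul_unitSphere σ hs0.le, Pi.zero_apply, add_zero, mem_Ici, not_and, not_lt]
          exact ⟨fun h => h.2 h.1, fun h => ⟨hσ, fun _ => h⟩⟩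
        by_cases h : s ∈ Ici ρ
        · rw [indicator_of_mem h, indicator_of_mem (hmem.2 h),
            ← ENNReal.ofReal_mul (by positivity), ← ENNReal.ofReal_mul (hJpos σ hσ).le,
            mul_comm (J σ), ← hΦ σ hσ s hs0]
          rfl
        · rw [indicator_of_notMem h, indicator_of_notMem (fun h' => h (hmem.1 h')), mul_zero]
      rw [setLIntegral_congr_fun measurableSet_Ioi e1, setLIntegral_indicator measurableSet_Ici,
        inter_eq_self_of_subset_left (Ici_subset_Ioi.2 hρ)]
      exact setLIntegral_congr Ioi_ae_eq_Ici.symm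
    · filter_upwards [ae_restrict_mem measurableSet_Ioi] with s hs
      exact (gaussProfile_pos (hρ.trans hs)).le
    · filter_upwards [ae_restrict_mem (isOpen_upperSphere n).measurableSet] with σ hσ
      exact (hJpos σ hσ).le
  have h1 := hiso r hr _ hmeas sdiff_subset (by rw [hcompl, hball, hvol])
  have h2 := (le_weightedPerimeter_halfBall hc hd hr).trans
    (h1.trans (hGρ.weightedPerimeter_le hρ hc hd hpos).2)
  rw [EReal.coe_le_coe_iff] at h2
  simp only [Pi.zero_apply, add_zero, ne_eq, OfNat.ofNat_ne_zero, not_false_eq_true, zero_pow,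
    one_mul] at h2
  rw [hA r hr, hA ρ hρ] at h2
  exact absurd (le_of_mul_le_mul_right h2 hJ0) (not_le.2 hlt)

end

/-! ### Extending the density past the boundary -/

section

section Extension

variable {n : ℕ} {φ : Space n → ℝ}

/-- The nearest point projection onto the closed half space. Composing a density with it gives a
continuous function on the whole space with the same values on the half space. -/
def halfSpaceProj (n : ℕ) (x : Space n) : Space n :=
  x + max (-x (Fin.last n)) 0 • EuclideanSpace.single (Fin.last n) (1 : ℝ)

lemma continuous_halfSpaceProj (n : ℕ) : Continuous (halfSpaceProj n) := by
  unfold halfSpaceProj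
  fun_prop

lemma halfSpaceProj_of_mem {x : Space n} (hx : x ∈ halfSpace n) : halfSpaceProj n x = x := by
  have : -x (Fin.last n) ≤ 0 := neg_nonpos.2 (le_of_lt hx)
  simp [halfSpaceProj, max_eq_right this]

lemma halfSpaceProj_mem_closure (x : Space n) : halfSpaceProj n x ∈ closure (halfSpace n) := by
  have h0 : 0 ≤ halfSpaceProj n x (Fin.last n) := by
    simp only [halfSpaceProj, PiLp.add_apply, PiLp.smul_apply, PiLp.single_apply,
      if_true, smul_eq_mul, mul_one]
    linarith [le_max_left (-x (Fin.last n)) 0]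
  have hlim : Tendsto (fun ε : ℝ => halfSpaceProj n x +
      ε • EuclideanSpace.single (Fin.last n) (1 : ℝ)) (𝓝[>] 0) (𝓝 (halfSpaceProj n x)) :=
    tendsto_nhdsWithin_of_tendsto_nhds (Continuous.tendsto' (by fun_prop) _ _ (by simp))
  refine mem_closure_of_tendsto hlim (eventually_nhdsWithin_of_forall fun ε hε => ?_)
  have hε' : 0 < ε := hε
  simp only [halfSpace, mem_ofPred_eq, PiLp.add_apply, PiLp.smul_apply,
    PiLp.single_apply, if_true, smul_eq_mul, mul_one]
  linarith

lemma weightedVolume_congr {ψ : Space n → ℝ} (h : EqOn φ ψ (halfSpace n)) {M : Set (Space n)}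
    (hM : MeasurableSet M) (hMs : M ⊆ halfSpace n) : weightedVolume φ M = weightedVolume ψ M :=
  setLIntegral_congr_fun hM fun x hx => by simp only [h (hMs hx)]

lemma weightedPerimeter_congr {ψ : Space n → ℝ} (h : EqOn φ ψ (halfSpace n)) {M : Set (Space n)}
    (hM : MeasurableSet M) (hMs : M ⊆ halfSpace n) :
    weightedPerimeter (halfSpace n) φ M = weightedPerimeter (halfSpace n) ψ M := by
  unfold weightedPerimeter
  refine iSup_congr fun v => iSup_congr fun _ => ?_
  rw [setIntegral_congr_fun hM fun x hx => ?_]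
  have : (fun y => φ y • v y) =ᶠ[𝓝 x] fun y => ψ y • v y := by
    filter_upwards [(isOpen_halfSpace n).mem_nhds (hMs hx)] with y hy
    rw [h hy]
  simp only [divergence, this.fderiv_eq]

lemma halfBallsMinimize_of_profile {ψ : Space n → ℝ} (h : EqOn φ ψ (halfSpace n))
    (hiso : ∀ R : ℝ, 0 < R →
      isoperimetricProfile (halfSpace n) φ
          (weightedVolume φ (Metric.ball 0 R ∩ halfSpace n)) =
        weightedPerimeter (halfSpace n) φ (Metric.ball 0 R ∩ halfSpace n)) :
    HalfBallsMinimize ψ := by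
  intro R hR M hM hMs hvol
  have hB : MeasurableSet (Metric.ball (0 : Space n) R ∩ halfSpace n) :=
    Metric.isOpen_ball.measurableSet.inter (isOpen_halfSpace n).measurableSet
  rw [← weightedVolume_congr h hM hMs, ← weightedVolume_congr h hB inter_subset_right] at hvol
  rw [← weightedPerimeter_congr h hM hMs, ← weightedPerimeter_congr h hB inter_subset_right,
    ← hiso R hR]
  exact sInf_le ⟨M, hM.nullMeasurableSet, hMs, hvol, rfl⟩

end Extension

/-! ### The functional equation -/

section FunctionalEquation

/-- Differentiating the equation in `u` shows that `h` has constant derivative. -/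
lemma exists_affine_of_add_sq {h g : ℝ → ℝ} (hd : DifferentiableOn ℝ h (Ioi 0))
    (heq : ∀ u, 0 < u → ∀ s, h (u + s ^ 2) = h u + g s) :
    ∃ d e : ℝ, ∀ u, 0 < u → h u = e + d * u := by
  have hda : ∀ u, 0 < u → DifferentiableAt ℝ h u := fun u hu =>
    (hd u hu).differentiableAt (Ioi_mem_nhds hu)
  have hshift : ∀ u, 0 < u → ∀ v, u ≤ v → deriv h v = deriv h u := by
    intro u hu v huv
    have hs : u + Real.sqrt (v - u) ^ 2 = v := by rw [Real.sq_sqrt (by linarith)]; ring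
    have h1 : HasDerivAt (fun w => h (w + Real.sqrt (v - u) ^ 2)) (deriv h v) u := by
      refine HasDerivAt.comp_add_const u _ ?_
      rw [hs]
      exact (hda v (by linarith)).hasDerivAt
    have h2 : HasDerivAt (fun w => h (w + Real.sqrt (v - u) ^ 2)) (deriv h u) u := by
      refine ((hda u hu).hasDerivAt.add_const (g (Real.sqrt (v - u)))).congr_of_eventuallyEq ?_
      filter_upwards [Ioi_mem_nhds hu] with w hw
      exact heq w hw _
    exact h1.unique h2
  have hconst : ∀ u, 0 < u → deriv h u = deriv h 1 := by
    intro u hu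
    rcases le_total u 1 with h1 | h1
    · exact (hshift u hu 1 h1).symm
    · exact hshift 1 one_pos u h1
  refine ⟨deriv h 1, h 1 - deriv h 1, fun u hu => ?_⟩
  have haff : ∀ u, HasDerivAt (fun u => h 1 - deriv h 1 + deriv h 1 * u) (deriv h 1) u := by
    intro u
    simpa using ((hasDerivAt_id u).const_mul (deriv h 1)).const_add (h 1 - deriv h 1)
  exact isOpen_Ioi.eqOn_of_deriv_eq isPreconnected_Ioi hd
    (fun u _ => (haff u).differentiableAt.differentiableWithinAt)
    (fun u hu => by rw [hconst u hu, (haff u).deriv])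
    (show (1 : ℝ) ∈ Ioi 0 from zero_lt_one (α := ℝ))
    (by ring) hu

lemma eq_exp_of_mul_deriv {f : ℝ → ℝ} {d : ℝ} (hf : ContDiff ℝ 1 f) (hpos : ∀ t, 0 < f t)
    (hd : ∀ t, t * deriv f t / f t = d * t ^ 2) (t : ℝ) :
    f t = f 0 * Real.exp (d / 2 * t ^ 2) := by
  have hode : deriv f = fun t => d * t * f t := by
    refine Continuous.ext_on (dense_compl_singleton (0 : ℝ)) (hf.continuous_deriv le_rfl)
      (by have := hf.continuous; fun_prop) fun t ht => ?_
    have ht0 : t ≠ 0 := ht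
    have h1 := hd t
    rw [div_eq_iff (hpos t).ne'] at h1
    refine mul_left_cancel₀ ht0 ?_
    linear_combination h1
  have hq : ∀ t, HasDerivAt (fun t => f t * Real.exp (-(d / 2 * t ^ 2))) 0 t := by
    intro t
    have h1 := (hf.differentiable one_ne_zero t).hasDerivAt
    have h2 : HasDerivAt (fun t : ℝ => -(d / 2 * t ^ 2)) (-(d / 2 * (2 * t))) t := by
      refine ((hasDerivAt_pow 2 t).const_mul (d / 2)).neg.congr_deriv ?_
      simp
    refine (h1.mul h2.exp).congr_deriv ?_
    rw [hode]
    ring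
  have hc := is_const_of_deriv_eq_zero (fun t => (hq t).differentiableAt)
    (fun t => (hq t).deriv) t 0
  simp only [ne_eq, OfNat.ofNat_ne_zero, not_false_eq_true, zero_pow, mul_zero, neg_zero,
    Real.exp_zero, mul_one] at hc
  rw [← hc, mul_assoc, ← Real.exp_add]
  simp

lemma eq_rpow_mul_exp_of_mul_deriv {f : ℝ → ℝ} {d e : ℝ} (hf : DifferentiableOn ℝ f (Ioi 0))
    (hpos : ∀ t, 0 < t → 0 < f t)
    (hd : ∀ t, 0 < t → t * deriv f t / f t = e + d * t ^ 2) {t : ℝ} (ht : 0 < t) :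
    f t = f 1 * Real.exp (-(d / 2)) * t ^ e * Real.exp (d / 2 * t ^ 2) := by
  have h1 : ∀ t, 0 < t → HasDerivAt (fun t => Real.log (f t)) (deriv f t / f t) t := fun t ht =>
    ((hf t ht).differentiableAt (Ioi_mem_nhds ht)).hasDerivAt.log (hpos t ht).ne'
  have h2 : ∀ t, 0 < t → HasDerivAt
      (fun t => Real.log (f 1) + (e * Real.log t + (d / 2 * t ^ 2 - d / 2)))
      (e * t⁻¹ + d / 2 * (2 * t)) t := by
    intro t ht
    have := (((Real.hasDerivAt_log ht.ne').const_mul e).add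
      (((hasDerivAt_pow 2 t).const_mul (d / 2)).sub_const (d / 2))).const_add (Real.log (f 1))
    simpa using this
  have h3 := isOpen_Ioi.eqOn_of_deriv_eq isPreconnected_Ioi
    (fun t ht => (h1 t ht).differentiableAt.differentiableWithinAt)
    (fun t ht => (h2 t ht).differentiableAt.differentiableWithinAt)
    (fun t ht => by
      rw [(h1 t ht).deriv, (h2 t ht).deriv]
      have ht0 : t ≠ 0 := ne_of_gt ht
      refine mul_left_cancel₀ ht0 ?_
      rw [← mul_div_assoc, hd t ht]
      field_simp)
    (show (1 : ℝ) ∈ Ioi 0 from zero_lt_one (α := ℝ)) (by simp) ht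
  simp only at h3
  rw [← Real.exp_log (hpos t ht), h3, Real.exp_add, Real.exp_log (hpos 1 one_pos), Real.exp_add,
    Real.rpow_def_of_pos ht, sub_eq_add_neg, Real.exp_add, mul_comm e]
  ring

/-- A negative power times a function that does not vanish at the origin is unbounded there. -/
lemma nonneg_of_continuousWithinAt_rpow_mul {f u : ℝ → ℝ} {e : ℝ}
    (hf : ContinuousWithinAt f (Ioi 0) 0) (hu : ContinuousAt u 0) (hu0 : u 0 ≠ 0)
    (h : ∀ t, 0 < t → f t = t ^ e * u t) : 0 ≤ e := by
  by_contra hneg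
  rw [not_le] at hneg
  have h1 : Tendsto (fun t : ℝ => t ^ (-e)) (𝓝[>] 0) (𝓝 0) := by
    refine tendsto_nhdsWithin_of_tendsto_nhds ?_
    have := (Real.continuous_rpow_const (q := -e) (by linarith)).tendsto 0
    rwa [Real.zero_rpow (by linarith)] at this
  have h2 : Tendsto u (𝓝[>] 0) (𝓝 0) := by
    have h3 := h1.mul hf.tendsto
    rw [zero_mul] at h3
    refine h3.congr' (eventually_nhdsWithin_of_forall fun t ht => ?_)
    have ht0 : 0 < t := ht
    rw [h t ht0, ← mul_assoc, ← Real.rpow_add ht0, neg_add_cancel, Real.rpow_zero, one_mul]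
  exact hu0 (tendsto_nhds_unique (tendsto_nhdsWithin_of_tendsto_nhds hu.tendsto) h2)

end FunctionalEquation

/-! ### Product densities -/

section Product

variable {n : ℕ} {φ : Space n → ℝ} {φi : Fin (n + 1) → ℝ → ℝ}

/-- The contribution `t * f' t / f t` of one factor to the radial logarithmic derivative of a
product. -/
def logSlope (f : ℝ → ℝ) (t : ℝ) : ℝ := t * deriv f t / f t

lemma logSlope_zero (f : ℝ → ℝ) : logSlope f 0 = 0 := by simp [logSlope]

lemma radialLogDeriv_prod (hd : ContDiffOn ℝ 1 φ (halfSpace n))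
    (hprod : ∀ x ∈ halfSpace n, φ x = ∏ i, φi i (x i)) {x : Space n} (hx : x ∈ halfSpace n)
    (hdiff : ∀ i, DifferentiableAt ℝ (φi i) (x i)) (hpos : ∀ i, 0 < φi i (x i)) :
    radialLogDeriv φ x = ∑ i, logSlope (φi i) (x i) := by
  have hφx : 0 < φ x := by rw [hprod x hx]; exact Finset.prod_pos fun i _ => hpos i
  have h1 : HasDerivAt (fun r : ℝ => φ (r • x)) (fderiv ℝ φ x x) 1 := by
    have := hasDerivAt_comp_smul (κ := φ) (r := 1) (x := x) (by
      rw [one_smul]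
      exact (hd.contDiffAt ((isOpen_halfSpace n).mem_nhds hx)).differentiableAt one_ne_zero)
    rwa [one_smul] at this
  have h2 := h1.log (by rw [one_smul]; exact hφx.ne')
  rw [one_smul] at h2
  have h3 : ∀ i ∈ (Finset.univ : Finset (Fin (n + 1))),
      HasDerivAt (fun r : ℝ => Real.log (φi i (r * x i))) (logSlope (φi i) (x i)) 1 := by
    intro i _
    have e1 : HasDerivAt (fun r : ℝ => r * x i) (x i) 1 := by
      simpa using (hasDerivAt_id (1 : ℝ)).mul_const (x i)
    have e2 : HasDerivAt (φi i) (deriv (φi i) (x i)) (1 * x i) := by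
      rw [one_mul]; exact (hdiff i).hasDerivAt
    have e3 := (e2.comp 1 e1).log (by simpa using (hpos i).ne')
    refine e3.congr_deriv ?_
    simp [logSlope, mul_comm]
  have h4 := HasDerivAt.fun_sum h3
  have h5 : (fun r : ℝ => Real.log (φ (r • x))) =ᶠ[𝓝 1]
      fun r => ∑ i, Real.log (φi i (r * x i)) := by
    have hev : ∀ᶠ r : ℝ in 𝓝 1, ∀ i, 0 < φi i (r * x i) := by
      rw [eventually_all]
      intro i
      have hct : ContinuousAt (fun r : ℝ => φi i (r * x i)) 1 := by
        refine ContinuousAt.comp (g := φi i) ?_ (by fun_prop)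
        rw [one_mul]; exact (hdiff i).continuousAt
      exact hct.eventually_const_lt (by simpa using hpos i)
    filter_upwards [hev, Ioi_mem_nhds (zero_lt_one (α := ℝ))] with r hr hr0
    rw [hprod _ ((smul_mem_halfSpace hr0 x).2 hx)]
    simp only [PiLp.smul_apply, smul_eq_mul]
    exact Real.log_prod fun i _ => (hr i).ne'
  exact (h2.congr_of_eventuallyEq h5.symm).unique h4

/-- The functional equation: compare the radial logarithmic derivative at `s • e_i + t • e_N` and
at the point of the `e_N`-axis of the same norm. -/
lemma logSlope_add_logSlope (hdiff : ∀ x ∈ halfSpace n, ∀ i, DifferentiableAt ℝ (φi i) (x i))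
    (hpos : ∀ x ∈ halfSpace n, ∀ i, 0 < φi i (x i))
    (hd : ContDiffOn ℝ 1 φ (halfSpace n))
    (hprod : ∀ x ∈ halfSpace n, φ x = ∏ i, φi i (x i))
    (hrad : ∀ x ∈ halfSpace n, ∀ y ∈ halfSpace n, ‖x‖ = ‖y‖ →
      radialLogDeriv φ x = radialLogDeriv φ y)
    {i : Fin (n + 1)} (hi : i ≠ Fin.last n) (s : ℝ) {t : ℝ} (ht : 0 < t) :
    logSlope (φi i) s + logSlope (φi (Fin.last n)) t =
      logSlope (φi (Fin.last n)) (Real.sqrt (s ^ 2 + t ^ 2)) := by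
  have hpt : 0 < s ^ 2 + t ^ 2 := by positivity
  set x : Space n := EuclideanSpace.single i s + EuclideanSpace.single (Fin.last n) t with hx_def
  set y : Space n := EuclideanSpace.single (Fin.last n) (Real.sqrt (s ^ 2 + t ^ 2)) with hy_def
  have hxi : x i = s := by simp [hx_def, hi]
  have hxl : x (Fin.last n) = t := by simp [hx_def, hi.symm]
  have hxo : ∀ j, j ≠ i ∧ j ≠ Fin.last n → x j = 0 := fun j hj => by
    simp [hx_def, hj.1, hj.2]
  have hx : x ∈ halfSpace n := by simpa [halfSpace, hxl] using ht
  have hy : y ∈ halfSpace n := by simpa [halfSpace, hy_def] using hpt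
  have hsum : ∀ F : Fin (n + 1) → ℝ → ℝ, (∀ j, F j 0 = 0) →
      ∑ j, F j (x j) = F i s + F (Fin.last n) t := by
    intro F hF
    rw [Finset.sum_eq_add i (Fin.last n) hi (fun j _ hj => by rw [hxo j hj, hF])
      (fun h => absurd (Finset.mem_univ _) h) (fun h => absurd (Finset.mem_univ _) h), hxi, hxl]
  have hxy : ‖x‖ = ‖y‖ := by
    have h1 : ‖x‖ ^ 2 = s ^ 2 + t ^ 2 := by
      rw [EuclideanSpace.real_norm_sq_eq]
      exact hsum (fun _ u => u ^ 2) (fun _ => by simp)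
    have h2 : ‖y‖ = Real.sqrt (s ^ 2 + t ^ 2) := by
      rw [hy_def, PiLp.norm_single, Real.norm_of_nonneg (Real.sqrt_nonneg _)]
    rw [h2, ← h1, Real.sqrt_sq (norm_nonneg _)]
  have h := hrad x hx y hy hxy
  rw [radialLogDeriv_prod hd hprod hx (hdiff x hx) (hpos x hx),
    radialLogDeriv_prod hd hprod hy (hdiff y hy) (hpos y hy),
    hsum (fun j => logSlope (φi j)) (fun j => logSlope_zero _),
    Finset.sum_eq_single (Fin.last n)
      (fun j _ hj => by simp [hy_def, hj, logSlope_zero])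
      (fun h => absurd (Finset.mem_univ _) h)] at h
  simpa [hy_def] using h

end Product

end

end WeightedIso

end

open WeightedIso in
theorem theorem2p8 (n : ℕ) (hn : 1 ≤ n)
    (φ : EuclideanSpace ℝ (Fin (n + 1)) → ℝ) (φi : Fin (n + 1) → ℝ → ℝ)
    (hφ_smooth : ContDiffOn ℝ 1 φ (WeightedIso.halfSpace n))
    (hφ_cont : ContinuousOn φ (closure (WeightedIso.halfSpace n)))
    (hφ_prod : ∀ x ∈ WeightedIso.halfSpace n, φ x = ∏ i, φi i (x i))
    (hφi_smooth : ∀ i, i ≠ Fin.last n → ContDiff ℝ 2 (φi i))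
    (hφi_pos : ∀ i, i ≠ Fin.last n → ∀ t : ℝ, 0 < φi i t)
    (hφN_smooth : ContDiffOn ℝ 2 (φi (Fin.last n)) (Set.Ioi 0))
    (hφN_cont : ContinuousOn (φi (Fin.last n)) (Set.Ici 0))
    (hφN_pos : ∀ t : ℝ, 0 < t → 0 < φi (Fin.last n) t)
    (hiso : ∀ R : ℝ, 0 < R →
      WeightedIso.isoperimetricProfile (WeightedIso.halfSpace n) φ
          (WeightedIso.weightedVolume φ (Metric.ball 0 R ∩ WeightedIso.halfSpace n)) =
        WeightedIso.weightedPerimeter (WeightedIso.halfSpace n) φ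
          (Metric.ball 0 R ∩ WeightedIso.halfSpace n)) :
    ∃ a k c : ℝ, 0 < a ∧ 0 ≤ k ∧ 0 ≤ c ∧
      ∀ x ∈ WeightedIso.halfSpace n,
        φ x = a * x (Fin.last n) ^ k * Real.exp (c * ‖x‖ ^ 2) := by
  set ψ : Space n → ℝ := fun x => φ (halfSpaceProj n x) with hψ
  have hEq : EqOn φ ψ (halfSpace n) := fun x hx => by
    simp only [hψ]; rw [halfSpaceProj_of_mem hx]
  have hψc : Continuous ψ :=
    hφ_cont.comp_continuous (continuous_halfSpaceProj n) halfSpaceProj_mem_closure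
  have hψd : ContDiffOn ℝ 1 ψ (halfSpace n) := hφ_smooth.congr fun x hx => (hEq hx).symm
  have hψprod : ∀ x ∈ halfSpace n, ψ x = ∏ i, φi i (x i) := fun x hx =>
    (hEq hx).symm.trans (hφ_prod x hx)
  have hNd : ∀ t : ℝ, 0 < t → DifferentiableAt ℝ (φi (Fin.last n)) t := fun t ht =>
    (hφN_smooth.contDiffAt (Ioi_mem_nhds ht)).differentiableAt two_ne_zero
  have hdiff : ∀ x ∈ halfSpace n, ∀ i, DifferentiableAt ℝ (φi i) (x i) := by
    intro x hx i
    by_cases hi : i = Fin.last n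
    · subst hi; exact hNd _ hx
    · exact (hφi_smooth i hi).differentiable two_ne_zero _
  have hpos : ∀ x ∈ halfSpace n, ∀ i, 0 < φi i (x i) := by
    intro x hx i
    by_cases hi : i = Fin.last n
    · subst hi; exact hφN_pos _ hx
    · exact hφi_pos i hi _
  have hψpos : ∀ x ∈ halfSpace n, 0 < ψ x := fun x hx => by
    rw [hψprod x hx]; exact Finset.prod_pos fun i _ => hpos x hx i
  have hmin : HalfBallsMinimize ψ := halfBallsMinimize_of_profile hEq hiso
  have hfun : ∀ i, i ≠ Fin.last n → ∀ s t : ℝ, 0 < t →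
      logSlope (φi i) s + logSlope (φi (Fin.last n)) t =
        logSlope (φi (Fin.last n)) (Real.sqrt (s ^ 2 + t ^ 2)) := fun i hi s t ht =>
    logSlope_add_logSlope hdiff hpos hψd hψprod
      (fun x hx y hy hxy => hmin.radialLogDeriv_eq hψc hψd hψpos hx hy hxy) hi s ht
  have hshift : ∀ i, i ≠ Fin.last n → ∀ u, 0 < u → ∀ s,
      logSlope (φi (Fin.last n)) (Real.sqrt (u + s ^ 2)) =
        logSlope (φi (Fin.last n)) (Real.sqrt u) + logSlope (φi i) s := by
    intro i hi u hu s
    have := hfun i hi s (Real.sqrt u) (Real.sqrt_pos.2 hu)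
    rw [Real.sq_sqrt hu.le, add_comm (s ^ 2)] at this
    rw [← this, add_comm]
  have hslope_diff : DifferentiableOn ℝ
      (fun u => logSlope (φi (Fin.last n)) (Real.sqrt u)) (Ioi 0) := by
    intro u hu
    have hu0 : 0 < u := hu
    have hsq := Real.sqrt_pos.2 hu0
    have h1 : DifferentiableAt ℝ (deriv (φi (Fin.last n))) (Real.sqrt u) :=
      ((hφN_smooth.deriv_of_isOpen (m := 1) isOpen_Ioi (by norm_num)).differentiableOn
        one_ne_zero).differentiableAt (Ioi_mem_nhds hsq)
    have h2 : DifferentiableAt ℝ (logSlope (φi (Fin.last n))) (Real.sqrt u) :=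
      (differentiableAt_id.mul h1).div (hNd _ hsq) (hφN_pos _ hsq).ne'
    exact (h2.comp u (Real.hasDerivAt_sqrt hu0.ne').differentiableAt).differentiableWithinAt
  have h0 : (0 : Fin (n + 1)) ≠ Fin.last n := by
    intro h
    have := congrArg Fin.val h
    simp only [Fin.val_zero, Fin.val_last] at this
    omega
  obtain ⟨d, e, hde⟩ := exists_affine_of_add_sq hslope_diff (hshift 0 h0)
  have hi_slope : ∀ i, i ≠ Fin.last n → ∀ s, logSlope (φi i) s = d * s ^ 2 := by
    intro i hi s
    have h1 := hshift i hi 1 one_pos s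
    rw [hde _ (by positivity), hde 1 one_pos] at h1
    linarith
  have hN_slope : ∀ t, 0 < t → logSlope (φi (Fin.last n)) t = e + d * t ^ 2 := by
    intro t ht
    have := hde (t ^ 2) (by positivity)
    simpa only [Real.sqrt_sq ht.le] using this
  have hi_eq : ∀ i, i ≠ Fin.last n → ∀ s, φi i s = φi i 0 * Real.exp (d / 2 * s ^ 2) :=
    fun i hi s => eq_exp_of_mul_deriv ((hφi_smooth i hi).of_le (by norm_num)) (hφi_pos i hi)
      (hi_slope i hi) s
  have hN_eq : ∀ t, 0 < t → φi (Fin.last n) t = φi (Fin.last n) 1 * Real.exp (-(d / 2)) * t ^ e *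
      Real.exp (d / 2 * t ^ 2) := fun t ht =>
    eq_rpow_mul_exp_of_mul_deriv (fun t ht => (hNd t ht).differentiableWithinAt) hφN_pos
      hN_slope ht
  have he : 0 ≤ e := by
    refine nonneg_of_continuousWithinAt_rpow_mul (f := φi (Fin.last n))
      (u := fun t => φi (Fin.last n) 1 * Real.exp (-(d / 2)) * Real.exp (d / 2 * t ^ 2))
      ((hφN_cont 0 self_mem_Ici).mono Ioi_subset_Ici_self) (by fun_prop)
      (mul_ne_zero (mul_ne_zero (hφN_pos 1 one_pos).ne' (Real.exp_ne_zero _))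
        (Real.exp_ne_zero _)) fun t ht => ?_
    rw [hN_eq t ht]; ring
  set a : ℝ := (∏ i : Fin n, φi i.castSucc 0) * (φi (Fin.last n) 1 * Real.exp (-(d / 2))) with ha
  have hform : ∀ x ∈ halfSpace n,
      φ x = a * x (Fin.last n) ^ e * Real.exp (d / 2 * ‖x‖ ^ 2) := by
    intro x hx
    rw [hφ_prod x hx, Fin.prod_univ_castSucc, hN_eq _ hx,
      Finset.prod_congr rfl fun i _ => hi_eq i.castSucc (Fin.castSucc_lt_last i).ne (x i.castSucc),
      Finset.prod_mul_distrib, ← Real.exp_sum, ← Finset.mul_sum,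
      EuclideanSpace.real_norm_sq_eq, Fin.sum_univ_castSucc, mul_add, Real.exp_add, ha]
    ring
  refine ⟨a, e, d / 2, ?_, he, ?_, hform⟩
  · exact mul_pos (Finset.prod_pos fun i _ => hφi_pos _ (Fin.castSucc_lt_last i).ne 0)
      (mul_pos (hφN_pos 1 one_pos) (Real.exp_pos _))
  · exact hmin.exponent_nonneg hψc hψd hψpos he fun x hx =>
      (hEq hx).symm.trans (hform x hx)
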